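/- Let $A\in\mathbb R^{n\times n}$, $B\in\mathbb R^{n\times m}$ and suppose that $(A,B)$ is controllable, i.e. $\operatorname{rank}[B, AB,\dots,A^{n-1}B]=n$. Equip $\mathbb R^{m\times n}$ with its usual topology. (1) Let $x\in\mathbb R^n$, $x\neq 0$. Then the set $$\mathcal W=\{K\in\mathbb R^{m\times n} : \langle v,x\rangle\neq 0 \text{ for all eigenpairs } (\lambda,v)\in\mathbb C\times\mathbb C^n \text{ of } A-BK\}$$ is dense in $\mathbb R^{m\times n}$. (2) Let $Q\in\mathbb R^{n\times n}$ be symmetric positive semidefinite, $R\in\mathbb R^{m\times m}$ symmetric positive definite, and $x_0\in\mathbb R^n$, $x_0\neq 0$. For $K\in\mathbb R^{m\times n}$ put $$J_{x_0}(K)=\sum_{k=0}^\infty\Big[\langle (A-BK)^kx_0,\,Q(A-BK)^kx_0\rangle+\langle K(A-BK)^kx_0,\,RK(A-BK)^kx_0\rangle\Big]\in[0,\infty],$$ and let $\operatorname{dom}(J_{x_0})=\{K : J_{x_0}(K)<\infty\}$. Then the interior of $\operatorname{dom}(J_{x_0})$ is exactly the set $\mathcal S=\{K\in\mathbb R^{m\times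 n} : \rho(A-BK)<1\}$ of Schur stabilizing gains, where $\rho$ denotes the spectral radius. -/

import Mathlib

namespace LQR

noncomputable section

/-- The matrix `[B, AB, A²B, …, Aⁿ⁻¹B]`; the columns of the `j`-th block are indexed by the pairs
`(j, l)`. -/
def kalmanMatrix {n m : ℕ} (A : Matrix (Fin n) (Fin n) ℝ) (B : Matrix (Fin n) (Fin m) ℝ) :
    Matrix (Fin n) (Fin n × Fin m) ℝ :=
  Matrix.of fun i p => (A ^ (p.1 : ℕ) * B) i p.2

/-- Controllability of the pair `(A, B)`: the Kalman rank condition. -/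
def IsControllable {n m : ℕ} (A : Matrix (Fin n) (Fin n) ℝ) (B : Matrix (Fin n) (Fin m) ℝ) :
    Prop :=
  (kalmanMatrix A B).rank = n

/-- The closed-loop matrix `A - BK`. -/
def closedLoop {n m : ℕ} (A : Matrix (Fin n) (Fin n) ℝ) (B : Matrix (Fin n) (Fin m) ℝ)
    (K : Matrix (Fin m) (Fin n) ℝ) : Matrix (Fin n) (Fin n) ℝ :=
  A - B * K

/-- The closed-loop matrix `A - BK` with its entries regarded as complex numbers. -/
def closedLoopC {n m : ℕ} (A : Matrix (Fin n) (Fin n) ℝ) (B : Matrix (Fin n) (Fin m) ℝ)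
    (K : Matrix (Fin m) (Fin n) ℝ) : Matrix (Fin n) (Fin n) ℂ :=
  (closedLoop A B K).map ((↑) : ℝ → ℂ)

/-- The set `S` of Schur stabilizing feedback gains: `ρ(A - BK) < 1`, where the spectral radius
is taken over all complex eigenvalues. -/
def schurStabilizing {n m : ℕ} (A : Matrix (Fin n) (Fin n) ℝ) (B : Matrix (Fin n) (Fin m) ℝ) :
    Set (Matrix (Fin m) (Fin n) ℝ) :=
  {K | spectralRadius ℂ (closedLoopC A B K) < 1}

/-- The set `W` of the gains `K` such that every (complex) eigenpair `(μ, v)` of `A - BK`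
satisfies `⟨v, x⟩ ≠ 0`, for the standard Hermitian inner product of `ℂⁿ`. -/
def nonOrthogonalGains {n m : ℕ} (A : Matrix (Fin n) (Fin n) ℝ) (B : Matrix (Fin n) (Fin m) ℝ)
    (x : Fin n → ℝ) : Set (Matrix (Fin m) (Fin n) ℝ) :=
  {K | ∀ (μ : ℂ) (v : Fin n → ℂ),
    Module.End.HasEigenvector (Matrix.toLin' (closedLoopC A B K)) μ v →
      star v ⬝ᵥ (fun i => (x i : ℂ)) ≠ 0}

/-- The state `(A - BK)ᵏ x₀` at time `k` under the feedback `u = -Kx`. -/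
def trajectory {n m : ℕ} (A : Matrix (Fin n) (Fin n) ℝ) (B : Matrix (Fin n) (Fin m) ℝ)
    (x₀ : Fin n → ℝ) (K : Matrix (Fin m) (Fin n) ℝ) (k : ℕ) : Fin n → ℝ :=
  Matrix.mulVec (closedLoop A B K ^ k) x₀

/-- The `k`-th summand `⟨x_k, Q x_k⟩ + ⟨K x_k, R K x_k⟩` of the cost, `x_k = (A - BK)ᵏ x₀`. -/
def stageCost {n m : ℕ} (A : Matrix (Fin n) (Fin n) ℝ) (B : Matrix (Fin n) (Fin m) ℝ)
    (Q : Matrix (Fin n) (Fin n) ℝ) (R : Matrix (Fin m) (Fin m) ℝ) (x₀ : Fin n → ℝ)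
    (K : Matrix (Fin m) (Fin n) ℝ) (k : ℕ) : ℝ :=
  trajectory A B x₀ K k ⬝ᵥ Matrix.mulVec Q (trajectory A B x₀ K k) +
    Matrix.mulVec K (trajectory A B x₀ K k) ⬝ᵥ
      Matrix.mulVec R (Matrix.mulVec K (trajectory A B x₀ K k))

/-- For `Q ⪰ 0` and `R ≻ 0` the summands of the cost are nonnegative, so `ENNReal.ofReal`
truncates nothing in the definition of `cost`. -/
theorem stageCost_nonneg {n m : ℕ} (A : Matrix (Fin n) (Fin n) ℝ)
    (B : Matrix (Fin n) (Fin m) ℝ) {Q : Matrix (Fin n) (Fin n) ℝ}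
    {R : Matrix (Fin m) (Fin m) ℝ} (hQ : Q.PosSemidef) (hR : R.PosDef) (x₀ : Fin n → ℝ)
    (K : Matrix (Fin m) (Fin n) ℝ) (k : ℕ) : 0 ≤ stageCost A B Q R x₀ K k := by
  have h1 := hQ.dotProduct_mulVec_nonneg (trajectory A B x₀ K k)
  have h2 := hR.posSemidef.dotProduct_mulVec_nonneg (Matrix.mulVec K (trajectory A B x₀ K k))
  simp only [star_trivial] at h1 h2
  exact add_nonneg h1 h2

/-- The single-initial-state LQR cost `J_{x₀}(K) ∈ [0, ∞]`, for `Q ⪰ 0` and `R ≻ 0`. -/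
def cost {n m : ℕ} (A : Matrix (Fin n) (Fin n) ℝ) (B : Matrix (Fin n) (Fin m) ℝ)
    (Q : Matrix (Fin n) (Fin n) ℝ) (R : Matrix (Fin m) (Fin m) ℝ) (x₀ : Fin n → ℝ)
    (K : Matrix (Fin m) (Fin n) ℝ) : ENNReal :=
  ∑' k : ℕ, ENNReal.ofReal (stageCost A B Q R x₀ K k)

/-- The effective domain `dom(J_{x₀}) = {K | J_{x₀}(K) < ∞}`. -/
def effectiveDomain {n m : ℕ} (A : Matrix (Fin n) (Fin n) ℝ) (B : Matrix (Fin n) (Fin m) ℝ)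
    (Q : Matrix (Fin n) (Fin n) ℝ) (R : Matrix (Fin m) (Fin m) ℝ) (x₀ : Fin n → ℝ) :
    Set (Matrix (Fin m) (Fin n) ℝ) :=
  {K | cost A B Q R x₀ K < ⊤}

end

end LQR

/-! Both parts rest on genericity: a function of the gain that is polynomial along every line and
nonzero at one gain is nonzero on a dense set, so a single good gain suffices. Heymann's lemma
(`IsReachable.exists_isCyclicVector`) supplies it: some feedback makes a given nonzero vector
cyclic, and a rank-one feedback then moves the whole spectrum to one real point.

For (1), no eigenvector of `M = A - BK` is orthogonal to `x` once `x` is cyclic for `Mᵀ`. By duality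
this asks that `M` be observable from the functional `x`, which `IsReachable.exists_observable`
achieves for one gain.

For (2), the Schur gains form an open set and their trajectories decay geometrically, so they lie in
the interior. Conversely, `Q` may be degenerate, so finite cost is only used to give `K Mᵏ x₀ → 0`.
For generic `K`, `x₀` is cyclic for `M` and `M` shares no eigenvalue with `A`. Then `K Mᵏ → 0`, and
an eigenvector `v` of `M` with `|μ| ≥ 1` would satisfy `K v = 0`, hence `A v = μ v`, which is
excluded (`mem_schurStabilizing_of_generic`). So the interior lies in the closure of the Schur
gains, where eigenvalues have modulus at most 1 (`norm_le_one_of_mem_closure`). A non-Schur gain in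
the interior could be moved, by an arbitrarily small step, to one with an eigenvalue of modulus
greater than 1 (`IsControllable.exists_destabilizing`): a contradiction. -/

namespace LQR

open Filter Topology Polynomial
open scoped Matrix ENNReal NNReal ComplexConjugate

/-! ### Cyclic vectors, Heymann's lemma and deadbeat control -/

section Cyclic

variable {V U : Type*} [AddCommGroup V] [Module ℝ V]
  [AddCommGroup U] [Module ℝ U]

/-- `x` is a cyclic vector of `N`: no proper `N`-invariant subspace contains it. -/
def IsCyclicVector (N : V →ₗ[ℝ] V) (x : V) : Prop :=
  ∀ W : Submodule ℝ V, (∀ v ∈ W, N v ∈ W) → x ∈ W → W = ⊤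

/-- No proper `a`-invariant subspace contains the range of `b`. -/
def IsReachable (a : V →ₗ[ℝ] V) (b : U →ₗ[ℝ] V) : Prop :=
  ∀ W : Submodule ℝ V, (∀ v ∈ W, a v ∈ W) → (∀ u, b u ∈ W) → W = ⊤

/-- The span of `x, N x, …, Nᵈ⁻¹ x`. -/
def krylov (N : V →ₗ[ℝ] V) (x : V) (d : ℕ) : Submodule ℝ V :=
  Submodule.span ℝ (Set.range fun j : Fin d => (N ^ (j : ℕ)) x)

theorem pow_apply_mem_krylov (N : V →ₗ[ℝ] V) (x : V) {d j : ℕ} (h : j < d) :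
    (N ^ j) x ∈ krylov N x d :=
  Submodule.subset_span ⟨⟨j, h⟩, rfl⟩

theorem krylov_invariant {N : V →ₗ[ℝ] V} {x : V} {d : ℕ} (h : (N ^ d) x ∈ krylov N x d) :
    ∀ v ∈ krylov N x d, N v ∈ krylov N x d := by
  intro v hv
  have : krylov N x d ≤ Submodule.comap N (krylov N x d) := by
    refine Submodule.span_le.2 ?_
    rintro _ ⟨j, rfl⟩
    change N ((N ^ (j : ℕ)) x) ∈ krylov N x d
    rw [← Module.End.mul_apply, ← pow_succ']
    rcases Nat.lt_or_ge (j + 1) d with hj | hj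
    · exact pow_apply_mem_krylov N x hj
    · have : (j : ℕ) + 1 = d := by omega
      rwa [this]
  exact this hv

theorem krylov_ne_top {N : V →ₗ[ℝ] V} {x : V} {d : ℕ} (h : d < Module.finrank ℝ V) :
    krylov N x d ≠ ⊤ := by
  intro ht
  have h1 := finrank_range_le_card (R := ℝ) (fun j : Fin d => (N ^ (j : ℕ)) x)
  rw [Set.finrank] at h1
  change Module.finrank ℝ (krylov N x d) ≤ _ at h1
  rw [ht, finrank_top, Fintype.card_fin] at h1
  omega

theorem linearIndependent_pow_succ {N : V →ₗ[ℝ] V} {x : V} {d : ℕ}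
    (h : LinearIndependent ℝ fun j : Fin d => (N ^ (j : ℕ)) x)
    (hx : (N ^ d) x ∉ krylov N x d) :
    LinearIndependent ℝ fun j : Fin (d + 1) => (N ^ (j : ℕ)) x := by
  have := h.finSnoc hx
  have hfun : (fun j : Fin (d + 1) => (N ^ (j : ℕ)) x) =
      Fin.snoc (fun j : Fin d => (N ^ (j : ℕ)) x) ((N ^ d) x) := by
    ext j
    refine Fin.lastCases ?_ (fun i => ?_) j <;> simp
  rw [hfun]
  exact this

/-- A cyclic vector generates linearly independent iterates. -/
theorem IsCyclicVector.linearIndependent {N : V →ₗ[ℝ] V} {x : V} (h : IsCyclicVector N x) :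
    ∀ d ≤ Module.finrank ℝ V, LinearIndependent ℝ fun j : Fin d => (N ^ (j : ℕ)) x := by
  intro d
  induction d with
  | zero => intro _; exact linearIndependent_empty_type
  | succ d ih =>
    intro hd
    refine linearIndependent_pow_succ (ih (by omega)) fun hmem => ?_
    -- The empty span need not contain `x`, so `d = 0` is treated apart: there `x = 0`, and
    -- cyclicity applied to `⊥` makes `V` trivial.
    rcases d with _ | d
    · simp only [krylov, pow_zero, Module.End.one_apply, Set.range_eq_empty,
        Submodule.span_empty, Submodule.mem_bot] at hmem
      have h2 := h ⊥ (by simp) (by simp [hmem])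
      have h3 := finrank_bot ℝ V
      rw [h2, finrank_top] at h3
      omega
    · exact krylov_ne_top (by omega)
        (h _ (krylov_invariant hmem) (by simpa using pow_apply_mem_krylov N x (Nat.succ_pos d)))

theorem isCyclicVector_of_linearIndependent [FiniteDimensional ℝ V] {N : V →ₗ[ℝ] V} {x : V}
    (h : LinearIndependent ℝ fun j : Fin (Module.finrank ℝ V) => (N ^ (j : ℕ)) x) :
    IsCyclicVector N x := by
  intro W hW hx
  have hpow : ∀ j : ℕ, (N ^ j) x ∈ W := by
    intro j
    induction j with
    | zero => simpa using hx
    | succ j ih => rw [pow_succ', Module.End.mul_apply]; exact hW _ ih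
  have := h.span_eq_top_of_card_eq_finrank' (by simp)
  rw [eq_top_iff, ← this]
  exact Submodule.span_le.2 (by rintro _ ⟨j, rfl⟩; exact hpow j)

/-- The coordinate functional of the last iterate. -/
theorem exists_dual_pow {N : V →ₗ[ℝ] V} {x : V} {d : ℕ}
    (h : LinearIndependent ℝ fun j : Fin (d + 1) => (N ^ (j : ℕ)) x) :
    ∃ φ : V →ₗ[ℝ] ℝ, (∀ j < d, φ ((N ^ j) x) = 0) ∧ φ ((N ^ d) x) = 1 := by
  obtain ⟨φ, hφ⟩ := LinearMap.exists_extend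
    ((Finsupp.lapply (Fin.last d) : (Fin (d + 1) →₀ ℝ) →ₗ[ℝ] ℝ) ∘ₗ h.repr)
  have key : ∀ j : Fin (d + 1), φ ((N ^ (j : ℕ)) x) = if j = Fin.last d then 1 else 0 := by
    intro j
    have h1 := LinearMap.congr_fun hφ ⟨_, Submodule.subset_span ⟨j, rfl⟩⟩
    simp only [LinearMap.comp_apply, Submodule.subtype_apply] at h1
    rw [h1, h.repr_eq_single j _ rfl]
    simp [Finsupp.single_apply]
  refine ⟨φ, fun j hj => ?_, ?_⟩
  · have := key ⟨j, by omega⟩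
    rw [if_neg (by simp [Fin.ext_iff]; omega)] at this
    exact this
  · simpa using key (Fin.last d)

/-- The perturbation acts only on iterates that `φ` sees, and the first `d` of them are invisible to
it. -/
theorem pow_add_smulRight_apply {N : V →ₗ[ℝ] V} {x y : V} {d : ℕ} {φ : V →ₗ[ℝ] ℝ}
    (h : ∀ j < d, φ ((N ^ j) x) = 0) :
    ∀ j ≤ d, ((N + φ.smulRight y) ^ j) x = (N ^ j) x := by
  intro j
  induction j with
  | zero => intro _; simp
  | succ j ih =>
    intro hj
    rw [pow_succ', Module.End.mul_apply, ih (by omega), LinearMap.add_apply,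
      LinearMap.smulRight_apply, h j (by omega), zero_smul, add_zero, pow_succ',
      Module.End.mul_apply]

/-- A reachable pair can be made cyclic at any nonzero vector by a feedback. -/
theorem IsReachable.exists_isCyclicVector [FiniteDimensional ℝ V] {a : V →ₗ[ℝ] V}
    {b : U →ₗ[ℝ] V} (h : IsReachable a b) {x : V} (hx : x ≠ 0) :
    ∃ k : V →ₗ[ℝ] U, IsCyclicVector (a + b ∘ₗ k) x := by
  suffices H : ∀ d, d + 1 ≤ Module.finrank ℝ V → ∃ k : V →ₗ[ℝ] U,
      LinearIndependent ℝ fun j : Fin (d + 1) => ((a + b ∘ₗ k) ^ (j : ℕ)) x by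
    have : Nontrivial V := ⟨x, 0, hx⟩
    have hpos : 0 < Module.finrank ℝ V := Module.finrank_pos
    obtain ⟨d, hd⟩ := Nat.exists_eq_succ_of_ne_zero hpos.ne'
    obtain ⟨k, hk⟩ := H d (by omega)
    refine ⟨k, isCyclicVector_of_linearIndependent ?_⟩
    rw [hd]
    exact hk
  intro d
  induction d with
  | zero =>
    intro _
    refine ⟨0, ?_⟩
    rw [zero_add, linearIndependent_unique_iff]
    simpa using hx
  | succ d ih =>
    intro hd
    obtain ⟨k, hk⟩ := ih (by omega)
    set N := a + b ∘ₗ k with hN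
    by_cases hmem : (N ^ (d + 1)) x ∈ krylov N x (d + 1)
    swap
    · exact ⟨k, linearIndependent_pow_succ hk hmem⟩
    have hinv := krylov_invariant hmem
    -- Otherwise the proper subspace `krylov N x (d + 1)`, invariant under `N`, would contain the
    -- range of `b` and so be invariant under `a = N - b k`, against reachability.
    obtain ⟨u, hu⟩ : ∃ u, b u ∉ krylov N x (d + 1) := by
      by_contra! hb
      refine krylov_ne_top (by omega) (h _ (fun v hv => ?_) hb)
      have : a v = N v - b (k v) := by simp [hN]
      rw [this]
      exact Submodule.sub_mem _ (hinv v hv) (hb _)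
    obtain ⟨φ, hφ0, hφ1⟩ := exists_dual_pow hk
    -- The new feedback keeps the iterates up to `d` and adds `b u` to the next one, which pushes it
    -- out of their span.
    refine ⟨k + φ.smulRight u, ?_⟩
    have hN' : a + b ∘ₗ (k + φ.smulRight u) = N + φ.smulRight (b u) := by
      ext v
      simp [hN, add_assoc]
    rw [hN']
    have hpow := pow_add_smulRight_apply (y := b u) hφ0
    have hfun : (fun j : Fin (d + 1) => ((N + φ.smulRight (b u)) ^ (j : ℕ)) x) =
        fun j : Fin (d + 1) => (N ^ (j : ℕ)) x := by
      ext j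
      exact hpow j (by omega)
    refine linearIndependent_pow_succ (by rw [hfun]; exact hk) ?_
    have hkr : krylov (N + φ.smulRight (b u)) x (d + 1) = krylov N x (d + 1) := by
      simp only [krylov]
      rw [hfun]
    rw [hkr, pow_succ', Module.End.mul_apply, hpow d le_rfl, LinearMap.add_apply,
      LinearMap.smulRight_apply, hφ1, one_smul, ← Module.End.mul_apply, ← pow_succ']
    intro hc
    exact hu ((Submodule.add_mem_iff_right _ hmem).1 hc)

theorem IsCyclicVector.sub_smul {N : V →ₗ[ℝ] V} {x : V} (h : IsCyclicVector N x) (r : ℝ) :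
    IsCyclicVector (N - r • 1) x := by
  intro W hW hx
  refine h W (fun v hv => ?_) hx
  have : N v = (N - r • 1) v + r • v := by simp
  rw [this]
  exact W.add_mem (hW v hv) (W.smul_mem r hv)

/-- Deadbeat control of a single-input system. -/
theorem IsCyclicVector.exists_isNilpotent [FiniteDimensional ℝ V] {N : V →ₗ[ℝ] V} {x : V}
    (h : IsCyclicVector N x) :
    ∃ φ : V →ₗ[ℝ] ℝ, IsNilpotent (N + φ.smulRight x) := by
  rcases Nat.eq_zero_or_pos (Module.finrank ℝ V) with h0 | hpos
  · have := Module.finrank_zero_iff.1 h0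
    exact ⟨0, 1, LinearMap.ext fun v => Subsingleton.elim _ _⟩
  obtain ⟨d, hd⟩ := Nat.exists_eq_succ_of_ne_zero hpos.ne'
  have hli := h.linearIndependent (d + 1) (by omega)
  obtain ⟨l, hl0, hl1⟩ := exists_dual_pow hli
  -- Since `l` kills `Nʲ x` for `j < d`, `l Mʲ = l Nʲ` for `j ≤ d` whatever `φ` is. Then `l Mᵈ⁺¹ = l
  -- Nᵈ⁺¹ + φ`, as `l (Nᵈ x) = 1`, and this choice makes it vanish.
  set φ : V →ₗ[ℝ] ℝ := -(l ∘ₗ N ^ (d + 1)) with hφ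
  set M := N + φ.smulRight x with hM
  have hlM : ∀ j ≤ d, ∀ v, l ((M ^ j) v) = l ((N ^ j) v) := by
    intro j
    induction j with
    | zero => intro _ v; simp
    | succ j ih =>
      intro hj v
      rw [pow_succ, Module.End.mul_apply, ih (by omega), hM, LinearMap.add_apply,
        LinearMap.smulRight_apply, map_add, map_add, map_smul, map_smul, hl0 j (by omega),
        smul_zero, add_zero, pow_succ, Module.End.mul_apply]
  have hlast : ∀ v, l ((M ^ (d + 1)) v) = 0 := by
    intro v
    rw [pow_succ, Module.End.mul_apply, hlM d le_rfl, hM, LinearMap.add_apply,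
      LinearMap.smulRight_apply, map_add, map_add, map_smul, map_smul, hl1, hφ]
    simp [pow_succ]
  have hobs : ∀ v, (∀ j ≤ d, l ((N ^ j) v) = 0) → v = 0 := by
    intro v hv
    have hspan := hli.span_eq_top_of_card_eq_finrank' (by simp [hd])
    have hvm : v ∈ Submodule.span ℝ (Set.range fun j : Fin (d + 1) => (N ^ (j : ℕ)) x) := by
      rw [hspan]; trivial
    obtain ⟨c, hc⟩ := (Submodule.mem_span_range_iff_exists_fun ℝ).1 hvm
    -- The system for the coefficients is triangular; it is solved from the top coefficient
    -- downwards.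
    have hc0 : ∀ i, ∀ j : Fin (d + 1), (j : ℕ) = d - i → c j = 0 := by
      intro i
      induction i using Nat.strong_induction_on with
      | _ i ih =>
      intro j hj
      have h1 := hv (d - j) (by omega)
      rw [← hc, map_sum, map_sum, Finset.sum_eq_single j] at h1
      · rw [map_smul, map_smul, ← Module.End.mul_apply, ← pow_add,
          Nat.sub_add_cancel (by omega), hl1] at h1
        simpa using h1
      · intro s _ hs
        rw [map_smul, map_smul, ← Module.End.mul_apply, ← pow_add]
        rcases lt_or_ge (s : ℕ) j with hsj | hsj
        · rw [hl0 _ (by omega), smul_zero]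
        · have : (s : ℕ) ≠ j := fun hh => hs (Fin.ext hh)
          rw [ih (d - s) (by omega) s (by omega), zero_smul]
      · simp
    rw [← hc]
    exact Finset.sum_eq_zero fun j _ => by rw [hc0 (d - j) j (by omega), zero_smul]
  refine ⟨φ, d + 1, LinearMap.ext fun v => hobs _ fun j hj => ?_⟩
  rw [← hlM j hj, ← Module.End.mul_apply, ← pow_add, add_comm, pow_add, Module.End.mul_apply]
  exact hlast _

end Cyclic

/-! ### Observability by feedback -/

section Observable

variable {V U : Type*} [NormedAddCommGroup V] [NormedSpace ℝ V]
  [AddCommGroup U] [Module ℝ U]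

/-- A functional that vanishes on all resolvents `(N - r)⁻¹ x` with `r` large vanishes on the
iterates of `x`. -/
theorem dual_apply_eq_zero_of_resolvent [FiniteDimensional ℝ V] (N : V →ₗ[ℝ] V) (x : V)
    {y : ℝ → V} {R : ℝ}
    (hy : ∀ r > R, N (y r) - r • y r = x) (c : V →ₗ[ℝ] ℝ) (hc : ∀ r > R, c (y r) = 0) :
    c x = 0 ∧ ∀ r > R, c (N (y r)) = 0 := by
  set N' := LinearMap.toContinuousLinearMap N
  -- From `r y = N y - x`. Thus `y r → 0`, while `c (N (y r)) = c x` is constant in `r`.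
  have hbound : ∀ r > max R (‖N'‖ + 1), ‖y r‖ ≤ ‖x‖ * (r - ‖N'‖)⁻¹ := by
    intro r hr
    have hrR := (max_lt_iff.1 hr).1
    have hrN := (max_lt_iff.1 hr).2
    have hnn := norm_nonneg N'
    have h1 : ‖r • y r‖ ≤ ‖N' (y r)‖ + ‖x‖ := by
      have : r • y r = N' (y r) - x := by
        rw [← hy r hrR]; simp [N']
      rw [this]
      exact norm_sub_le _ _
    rw [norm_smul, Real.norm_of_nonneg (by linarith)] at h1
    have h2 := N'.le_opNorm (y r)
    rw [← div_eq_mul_inv, le_div_iff₀ (by linarith)]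
    linarith
  have hlim : Tendsto y atTop (𝓝 0) := by
    refine squeeze_zero_norm' (a := fun r => ‖x‖ * (r - ‖N'‖)⁻¹)
      (eventually_atTop.2 ⟨max R (‖N'‖ + 1) + 1, fun r hr => hbound r (by linarith)⟩) ?_
    have h1 : Tendsto (fun r : ℝ => r - ‖N'‖) atTop atTop :=
      tendsto_atTop_add_const_right _ _ tendsto_id
    simpa using (tendsto_inv_atTop_zero.comp h1).const_mul ‖x‖
  have hcx : ∀ r > R, c (N (y r)) = c x := by
    intro r hr
    have := congrArg c (hy r hr)
    rw [map_sub, map_smul, hc r hr, smul_zero, sub_zero] at this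
    exact this
  have hcont : Tendsto (fun r => c (N (y r))) atTop (𝓝 0) := by
    have h := ((c ∘ₗ N).continuous_of_finiteDimensional.tendsto 0).comp hlim
    simpa [Function.comp_def] using h
  have h0 : c x = 0 := by
    refine tendsto_nhds_unique (tendsto_const_nhds.congr' ?_) hcont
    filter_upwards [eventually_gt_atTop R] with r hr
    exact (hcx r hr).symm
  exact ⟨h0, fun r hr => (hcx r hr).trans h0⟩

/-- For a cyclic vector `x` and a functional `c ≠ 0` there is `r` for which `N - r` is injective
and `c` does not vanish at `(N - r)⁻¹ x`. -/
theorem IsCyclicVector.exists_resolvent [FiniteDimensional ℝ V] {N : V →ₗ[ℝ] V} {x : V}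
    (h : IsCyclicVector N x)
    {c : V →ₗ[ℝ] ℝ} (hc : c ≠ 0) :
    ∃ r : ℝ, Function.Injective (N - r • (1 : V →ₗ[ℝ] V)) ∧
      ∃ y, (N - r • (1 : V →ₗ[ℝ] V)) y = x ∧ c y ≠ 0 := by
  set N' := LinearMap.toContinuousLinearMap N
  have hinj : ∀ r > ‖N'‖, Function.Injective (N - r • (1 : V →ₗ[ℝ] V)) := by
    intro r hr
    rw [← LinearMap.ker_eq_bot, LinearMap.ker_eq_bot']
    intro v hv
    have h1 : N' v = r • v := by
      simpa [sub_eq_zero, N'] using hv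
    have h2 := N'.le_opNorm v
    rw [h1, norm_smul, Real.norm_of_nonneg ((norm_nonneg _).trans hr.le)] at h2
    by_contra hv0
    have := norm_pos_iff.2 hv0
    nlinarith
  by_contra! hcon
  have hsurj : ∀ r > ‖N'‖, ∃ y, (N - r • (1 : V →ₗ[ℝ] V)) y = x := fun r hr =>
    LinearMap.injective_iff_surjective.1 (hinj r hr) x
  have : ∃ y : ℝ → V, ∀ r > ‖N'‖, (N - r • (1 : V →ₗ[ℝ] V)) (y r) = x := by
    choose! y hy using hsurj
    exact ⟨y, hy⟩
  obtain ⟨y, hy⟩ := this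
  have key : ∀ j : ℕ, ∀ r > ‖N'‖, c ((N ^ j) (y r)) = 0 := by
    intro j
    induction j with
    | zero => exact fun r hr => hcon r (hinj r hr) _ (hy r hr)
    | succ j ih =>
      intro r hr
      have := (dual_apply_eq_zero_of_resolvent N x (y := y) (R := ‖N'‖)
        (fun r hr => by simpa using hy r hr) (c ∘ₗ N ^ j) ih).2 r hr
      rw [pow_succ, Module.End.mul_apply]
      exact this
  have key' : ∀ j : ℕ, c ((N ^ j) x) = 0 := fun j =>
    (dual_apply_eq_zero_of_resolvent N x (y := y) (R := ‖N'‖)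
        (fun r hr => by simpa using hy r hr) (c ∘ₗ N ^ j) (key j)).1
  have hli := h.linearIndependent _ le_rfl
  have hspan := hli.span_eq_top_of_card_eq_finrank' (by simp)
  refine hc (LinearMap.ext_on_range hspan fun j => ?_)
  simpa using key' j

/-- If `M - r` is nilpotent and `c` vanishes on no eigenvector of `M`, then the functionals
`c ∘ Mʲ` have no nonzero common zero. -/
theorem eq_zero_of_isNilpotent {M : V →ₗ[ℝ] V} {r : ℝ} (hM : IsNilpotent (M - r • 1))
    {c : V →ₗ[ℝ] ℝ} (hc : ∀ v, M v = r • v → c v = 0 → v = 0) {v : V}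
    (hv : ∀ j : ℕ, c ((M ^ j) v) = 0) : v = 0 := by
  obtain ⟨p, hp⟩ := hM
  suffices H : ∀ p, ∀ v, (∀ j : ℕ, c ((M ^ j) v) = 0) →
      ((M - r • (1 : V →ₗ[ℝ] V)) ^ p) v = 0 → v = 0 from H p v hv (by simp [hp])
  intro p
  induction p with
  | zero => intro v _ h; simpa using h
  | succ p ih =>
    intro v hv h
    have h1 : (M - r • (1 : V →ₗ[ℝ] V)) v = 0 := by
      refine ih _ (fun j => ?_) ?_
      · have h2 := hv (j + 1)
        rw [pow_succ, Module.End.mul_apply] at h2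
        simp [h2, hv j]
      · rwa [pow_succ, Module.End.mul_apply] at h
    exact hc v (by simpa [sub_eq_zero] using h1) (by simpa using hv 0)

/-- A reachable pair can be made observable from any nonzero functional by a feedback. -/
theorem IsReachable.exists_observable [FiniteDimensional ℝ V] {a : V →ₗ[ℝ] V}
    {b : U →ₗ[ℝ] V} (h : IsReachable a b) {c : V →ₗ[ℝ] ℝ} (hc : c ≠ 0) :
    ∃ k : V →ₗ[ℝ] U, ∀ v, (∀ j : ℕ, c (((a + b ∘ₗ k) ^ j) v) = 0) → v = 0 := by
  obtain ⟨u, hu⟩ : ∃ u, b u ≠ 0 := by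
    by_contra! hb
    have h1 : (⊥ : Submodule ℝ V) = ⊤ := h ⊥ (by simp) (by simpa using hb)
    refine hc (LinearMap.ext fun v => ?_)
    have : v ∈ (⊥ : Submodule ℝ V) := by rw [h1]; trivial
    rw [(Submodule.mem_bot ℝ).1 this]; simp
  obtain ⟨k, hk⟩ := h.exists_isCyclicVector hu
  set N := a + b ∘ₗ k with hN
  obtain ⟨r, hr, y, hy, hcy⟩ := hk.exists_resolvent hc
  obtain ⟨φ, hφ⟩ := (hk.sub_smul r).exists_isNilpotent
  refine ⟨k + φ.smulRight u, fun v hv => ?_⟩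
  have hN' : a + b ∘ₗ (k + φ.smulRight u) = N + φ.smulRight (b u) := by
    ext v
    simp [hN, add_assoc]
  rw [hN'] at hv
  refine eq_zero_of_isNilpotent (r := r) (by rwa [add_sub_right_comm]) (fun v hv hcv => ?_) hv
  -- An eigenvector of the new closed loop for `r` is a multiple of the resolvent vector `y`, on
  -- which `c` does not vanish.
  have h1 : (N - r • (1 : V →ₗ[ℝ] V)) v = (N - r • (1 : V →ₗ[ℝ] V)) (-(φ v) • y) := by
    rw [map_smul, hy]
    simp only [LinearMap.add_apply, LinearMap.smulRight_apply] at hv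
    simp [← hv]
  have h2 := hr h1
  rw [h2, map_smul, smul_eq_mul] at hcv
  have h3 : -(φ v) = 0 := (mul_eq_zero.1 hcv).resolve_right hcy
  rw [h2, h3, zero_smul]

/-- A reachable pair admits a feedback with closed-loop spectrum `{r}`, for any real `r`. -/
theorem IsReachable.exists_isNilpotent [FiniteDimensional ℝ V] {a : V →ₗ[ℝ] V}
    {b : U →ₗ[ℝ] V} (h : IsReachable a b) (r : ℝ) :
    ∃ k : V →ₗ[ℝ] U, IsNilpotent (a + b ∘ₗ k - r • 1) := by
  by_cases hb : ∀ u, b u = 0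
  · have h1 : (⊥ : Submodule ℝ V) = ⊤ := h ⊥ (by simp) (by simpa using hb)
    have : Subsingleton V := (Submodule.subsingleton_iff ℝ).1 (subsingleton_of_bot_eq_top h1)
    exact ⟨0, 1, LinearMap.ext fun v => Subsingleton.elim _ _⟩
  push Not at hb
  obtain ⟨u, hu⟩ := hb
  obtain ⟨k, hk⟩ := h.exists_isCyclicVector hu
  obtain ⟨φ, hφ⟩ := (hk.sub_smul r).exists_isNilpotent
  refine ⟨k + φ.smulRight u, ?_⟩
  convert hφ using 1
  ext v
  simp
  abel

end Observable

/-! ### Generic properties of gains, and part (1) -/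

section Density

/-- On the line from `K` (at `t = 0`) to `K₀` (at `t = 1`) the function is a nonzero polynomial, so
it has finitely many zeros and `K` is a limit of nonzeros. -/
theorem dense_ne_zero_of_line {E : Type*} [AddCommGroup E] [Module ℝ E] [TopologicalSpace E]
    [ContinuousAdd E] [ContinuousSMul ℝ E] {g : E → ℝ}
    (hg : ∀ K D, ∃ p : ℝ[X], ∀ t : ℝ, g (K + t • D) = p.eval t) {K₀ : E} (h0 : g K₀ ≠ 0) :
    Dense {K | g K ≠ 0} := by
  intro K
  obtain ⟨p, hp⟩ := hg K (K₀ - K)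
  have hp0 : p ≠ 0 := by
    rintro rfl
    have := hp 1
    simp at this
    exact h0 this
  have hd : Dense ({t : ℝ | p.eval t = 0}ᶜ) := by
    refine ((p.roots.toFinset.finite_toSet).subset fun t ht => ?_).countable.dense_compl ℝ
    simpa [hp0] using ht
  have hc : Continuous fun t : ℝ => K + t • (K₀ - K) := by fun_prop
  have := map_mem_closure hc (hd 0) (t := {K | g K ≠ 0}) fun t ht => by
    simpa [hp] using ht
  simpa using this

variable {n m : ℕ}

/-- The matrix `[x, M x, …, Mⁿ⁻¹ x]`. -/
def krylovMatrix {R : Type*} [CommRing R] (M : Matrix (Fin n) (Fin n) R) (x : Fin n → R) :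
    Matrix (Fin n) (Fin n) R :=
  Matrix.of fun i j => (M ^ (j : ℕ) *ᵥ x) i

theorem krylovMatrix_map {R S : Type*} [CommRing R] [CommRing S] (f : R →+* S)
    (M : Matrix (Fin n) (Fin n) R) (x : Fin n → R) :
    f.mapMatrix (krylovMatrix M x) = krylovMatrix (f.mapMatrix M) (f ∘ x) := by
  ext i j
  simp only [krylovMatrix, RingHom.mapMatrix_apply, Matrix.map_apply, Matrix.of_apply]
  rw [RingHom.map_mulVec, ← RingHom.mapMatrix_apply, map_pow, RingHom.mapMatrix_apply]

/-- The closed-loop matrix at `K + t D`, with polynomial entries in `t`. -/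
noncomputable def closedLoopPoly (A : Matrix (Fin n) (Fin n) ℝ) (B : Matrix (Fin n) (Fin m) ℝ)
    (K D : Matrix (Fin m) (Fin n) ℝ) : Matrix (Fin n) (Fin n) ℝ[X] :=
  (closedLoop A B K).map C - (X : ℝ[X]) • (B * D).map C

theorem closedLoopPoly_eval (A : Matrix (Fin n) (Fin n) ℝ) (B : Matrix (Fin n) (Fin m) ℝ)
    (K D : Matrix (Fin m) (Fin n) ℝ) (t : ℝ) :
    (aeval t : ℝ[X] →ₐ[ℝ] ℝ).mapMatrix (closedLoopPoly A B K D) =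
      closedLoop A B (K + t • D) := by
  ext i j
  rw [closedLoopPoly, closedLoop, closedLoop, Matrix.mul_add, Matrix.mul_smul]
  simp [-Matrix.map_mul]
  ring

/-- Evaluation at `t` is a ring homomorphism, so the determinant may be formed over `ℝ[X]` first. -/
theorem det_krylovMatrix_line (A : Matrix (Fin n) (Fin n) ℝ) (B : Matrix (Fin n) (Fin m) ℝ)
    (x : Fin n → ℝ) (K D : Matrix (Fin m) (Fin n) ℝ) :
    ∃ p : ℝ[X], ∀ t : ℝ, (krylovMatrix (closedLoop A B (K + t • D)) x).det = p.eval t := by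
  refine ⟨(krylovMatrix (closedLoopPoly A B K D) (C ∘ x)).det, fun t => ?_⟩
  rw [← closedLoopPoly_eval, ← coe_evalRingHom, RingHom.map_det, krylovMatrix_map]
  congr 2
  ext i
  simp

theorem det_krylovMatrix_transpose_line (A : Matrix (Fin n) (Fin n) ℝ)
    (B : Matrix (Fin n) (Fin m) ℝ) (x : Fin n → ℝ) (K D : Matrix (Fin m) (Fin n) ℝ) :
    ∃ p : ℝ[X], ∀ t : ℝ, (krylovMatrix (closedLoop A B (K + t • D))ᵀ x).det = p.eval t := by
  refine ⟨(krylovMatrix (closedLoopPoly A B K D)ᵀ (C ∘ x)).det, fun t => ?_⟩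
  rw [← closedLoopPoly_eval, ← coe_evalRingHom, RingHom.map_det, krylovMatrix_map]
  congr 2
  ext i
  simp

theorem det_aeval_line (A : Matrix (Fin n) (Fin n) ℝ) (B : Matrix (Fin n) (Fin m) ℝ)
    (q : ℝ[X]) (K D : Matrix (Fin m) (Fin n) ℝ) :
    ∃ p : ℝ[X], ∀ t : ℝ, (aeval (closedLoop A B (K + t • D)) q).det = p.eval t := by
  refine ⟨(aeval (closedLoopPoly A B K D) q).det, fun t => ?_⟩
  rw [← closedLoopPoly_eval, aeval_algHom_apply, ← AlgHom.map_det, coe_aeval_eq_eval]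

theorem isReachable_of_isControllable {A : Matrix (Fin n) (Fin n) ℝ}
    {B : Matrix (Fin n) (Fin m) ℝ} (h : IsControllable A B) :
    IsReachable A.mulVecLin B.mulVecLin := by
  intro W hA hB
  have hpow : ∀ (j : ℕ) (u : Fin m → ℝ), (A ^ j) *ᵥ (B *ᵥ u) ∈ W := by
    intro j
    induction j with
    | zero => intro u; simpa using hB u
    | succ j ih =>
      intro u
      rw [pow_succ', ← Matrix.mulVec_mulVec]
      exact hA _ (ih u)
  have htop : LinearMap.range (kalmanMatrix A B).mulVecLin = ⊤ := by
    refine Submodule.eq_top_of_finrank_eq ?_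
    have h' : (kalmanMatrix A B).rank = n := h
    rw [Matrix.rank] at h'
    simpa using h'
  rw [eq_top_iff, ← htop, Matrix.range_mulVecLin]
  refine Submodule.span_le.2 ?_
  rintro _ ⟨p, rfl⟩
  have := hpow p.1 (Pi.single p.2 1)
  rw [Matrix.mulVec_mulVec, Matrix.mulVec_single_one] at this
  exact this

theorem mulVecLin_closedLoop (A : Matrix (Fin n) (Fin n) ℝ) (B : Matrix (Fin n) (Fin m) ℝ)
    (k : (Fin n → ℝ) →ₗ[ℝ] (Fin m → ℝ)) :
    (closedLoop A B (-(LinearMap.toMatrix' k))).mulVecLin = A.mulVecLin + B.mulVecLin ∘ₗ k := by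
  refine LinearMap.ext fun v => ?_
  simp only [closedLoop, Matrix.mulVecLin_apply, Matrix.sub_mulVec, ← Matrix.mulVec_mulVec,
    Matrix.neg_mulVec, Matrix.mulVec_neg, LinearMap.toMatrix'_mulVec, LinearMap.add_apply,
    LinearMap.comp_apply, sub_neg_eq_add]

theorem mulVecLin_pow_apply (M : Matrix (Fin n) (Fin n) ℝ) (j : ℕ) (v : Fin n → ℝ) :
    (M.mulVecLin ^ j) v = (M ^ j) *ᵥ v := by
  rw [← Matrix.toLin'_apply', ← Matrix.toLin'_pow, Matrix.toLin'_apply]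

theorem det_krylovMatrix_ne_zero {M : Matrix (Fin n) (Fin n) ℝ} {x : Fin n → ℝ}
    (h : IsCyclicVector M.mulVecLin x) : (krylovMatrix M x).det ≠ 0 := by
  rw [← isUnit_iff_ne_zero, ← Matrix.isUnit_iff_isUnit_det,
    ← Matrix.linearIndependent_cols_iff_isUnit]
  have hcol : (krylovMatrix M x).col = fun j : Fin n => (M.mulVecLin ^ (j : ℕ)) x := by
    ext j i
    simp [krylovMatrix, Matrix.col, mulVecLin_pow_apply]
  rw [hcol]
  exact h.linearIndependent n (by simp)

/-- A proper invariant subspace containing `x` is killed by a nonzero functional; its representing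
vector would be unobservable. -/
theorem isCyclicVector_transpose {M : Matrix (Fin n) (Fin n) ℝ} {x : Fin n → ℝ}
    (h : ∀ v : Fin n → ℝ, (∀ j : ℕ, x ⬝ᵥ (M ^ j *ᵥ v) = 0) → v = 0) :
    IsCyclicVector (Mᵀ).mulVecLin x := by
  intro W hW hx
  by_contra hne
  obtain ⟨f, hf0, hf⟩ := Submodule.exists_dual_map_eq_bot_of_lt_top (lt_top_iff_ne_top.2 hne)
    inferInstance
  have hpow : ∀ j : ℕ, (Mᵀ ^ j) *ᵥ x ∈ W := by
    intro j
    induction j with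
    | zero => simpa using hx
    | succ j ih => rw [pow_succ', ← Matrix.mulVec_mulVec]; exact hW _ ih
  have hfv : ∀ y, f y = y ⬝ᵥ fun i => f (Pi.single i 1) := by
    intro y
    conv_lhs => rw [pi_eq_sum_univ' y]
    simp [dotProduct, map_sum]
  have hz := h (fun i => f (Pi.single i 1)) fun j => by
    rw [Matrix.dotProduct_mulVec, ← Matrix.mulVec_transpose, Matrix.transpose_pow, ← hfv]
    have : f ((Mᵀ ^ j) *ᵥ x) ∈ W.map f := Submodule.mem_map_of_mem (hpow j)
    rw [hf] at this
    simpa using this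
  refine hf0 (LinearMap.ext fun y => ?_)
  rw [hfv, hz]
  simp

theorem IsControllable.dense_isCyclic {A : Matrix (Fin n) (Fin n) ℝ}
    {B : Matrix (Fin n) (Fin m) ℝ} (h : IsControllable A B) {x : Fin n → ℝ} (hx : x ≠ 0) :
    Dense {K | (krylovMatrix (closedLoop A B K) x).det ≠ 0} := by
  obtain ⟨k, hk⟩ := (isReachable_of_isControllable h).exists_isCyclicVector hx
  refine dense_ne_zero_of_line (det_krylovMatrix_line A B x) (K₀ := -(LinearMap.toMatrix' k)) ?_
  refine det_krylovMatrix_ne_zero ?_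
  rwa [mulVecLin_closedLoop]

theorem IsControllable.dense_isObservable {A : Matrix (Fin n) (Fin n) ℝ}
    {B : Matrix (Fin n) (Fin m) ℝ} (h : IsControllable A B) {x : Fin n → ℝ} (hx : x ≠ 0) :
    Dense {K | (krylovMatrix (closedLoop A B K)ᵀ x).det ≠ 0} := by
  have hc : (dotProductBilin ℝ ℝ x : (Fin n → ℝ) →ₗ[ℝ] ℝ) ≠ 0 := by
    intro h0
    refine hx (dotProduct_self_eq_zero.1 ?_)
    exact LinearMap.congr_fun h0 x
  obtain ⟨k, hk⟩ := (isReachable_of_isControllable h).exists_observable hc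
  refine dense_ne_zero_of_line (det_krylovMatrix_transpose_line A B x)
    (K₀ := -(LinearMap.toMatrix' k)) ?_
  refine det_krylovMatrix_ne_zero (isCyclicVector_transpose fun v hv => hk v fun j => ?_)
  rw [← mulVecLin_closedLoop, mulVecLin_pow_apply]
  exact hv j

/-- Generically, no eigenvalue of the closed loop is a root of a given polynomial. -/
theorem IsControllable.dense_isUnit_aeval {A : Matrix (Fin n) (Fin n) ℝ}
    {B : Matrix (Fin n) (Fin m) ℝ} (h : IsControllable A B) {q : ℝ[X]} (hq : q ≠ 0) :
    Dense {K | (aeval (closedLoop A B K) q).det ≠ 0} := by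
  obtain ⟨r, hr⟩ : ∃ r, q.eval r ≠ 0 := by
    by_contra! hc
    exact hq (Polynomial.funext (by simpa using hc))
  obtain ⟨k, p, hk⟩ := (isReachable_of_isControllable h).exists_isNilpotent r
  refine dense_ne_zero_of_line (det_aeval_line A B q) (K₀ := -(LinearMap.toMatrix' k)) ?_
  set M := closedLoop A B (-(LinearMap.toMatrix' k)) with hM
  have hnil : (M - algebraMap ℝ _ r) ^ p = 0 := by
    apply Matrix.toLin'.injective
    rw [Matrix.toLin'_pow, map_zero, ← hk, ← mulVecLin_closedLoop, map_sub, Matrix.toLin'_apply',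
      Algebra.algebraMap_eq_smul_one, map_smul, Matrix.toLin'_one]
    rfl
  -- As `q r ≠ 0` and `(M - r)ᵖ = 0`, the Bézout identity evaluated at `M` inverts `q(M)`.
  have hcop : IsCoprime q ((X - C r) ^ p) := by
    refine IsCoprime.pow_right ?_
    refine ((irreducible_X_sub_C r).coprime_iff_not_dvd.2 fun hd => hr ?_).symm
    exact dvd_iff_isRoot.1 hd
  obtain ⟨s, t, hst⟩ := hcop
  have h1 := congrArg (aeval M) hst
  rw [map_add, map_mul, map_mul, map_pow, map_sub, aeval_X, aeval_C, hnil, mul_zero, add_zero,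
    map_one] at h1
  have h2 := congrArg Matrix.det h1
  rw [Matrix.det_mul, Matrix.det_one] at h2
  exact right_ne_zero_of_mul_eq_one h2

/-- If `M v = μ v` and `v ⬝ x = 0`, then `v ⬝ (Mᵀ)ʲ x = μʲ (v ⬝ x) = 0`, so `v` annihilates every
column of an invertible matrix. -/
theorem mem_nonOrthogonalGains {A : Matrix (Fin n) (Fin n) ℝ} {B : Matrix (Fin n) (Fin m) ℝ}
    {x : Fin n → ℝ} {K : Matrix (Fin m) (Fin n) ℝ}
    (hK : (krylovMatrix (closedLoop A B K)ᵀ x).det ≠ 0) : K ∈ nonOrthogonalGains A B x := by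
  intro μ v hv hvx
  have hMv : closedLoopC A B K *ᵥ v = μ • v := by
    have := hv.apply_eq_smul
    rwa [Matrix.toLin'_apply] at this
  have hvx' : v ⬝ᵥ (fun i => (x i : ℂ)) = 0 := by
    have := congrArg star hvx
    simpa [dotProduct, mul_comm] using this
  have hpow : ∀ j : ℕ, (closedLoopC A B K ^ j) *ᵥ v = μ ^ j • v := by
    intro j
    induction j with
    | zero => simp
    | succ j ih =>
      rw [pow_succ', ← Matrix.mulVec_mulVec, ih, Matrix.mulVec_smul, hMv, smul_smul, pow_succ]
  refine hv.2 ?_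
  have hdet : (krylovMatrix (closedLoopC A B K)ᵀ (fun i => (x i : ℂ))).det ≠ 0 := by
    have h1 := krylovMatrix_map Complex.ofRealHom (closedLoop A B K)ᵀ x
    have h2 : Complex.ofRealHom.mapMatrix (closedLoop A B K)ᵀ = (closedLoopC A B K)ᵀ := rfl
    rw [h2] at h1
    have h3 := congrArg Matrix.det h1
    rw [← RingHom.map_det] at h3
    intro h4
    have h5 : Complex.ofRealHom (krylovMatrix (closedLoop A B K)ᵀ x).det = 0 := h3.trans h4
    exact hK (by simpa using h5)
  refine Matrix.eq_zero_of_vecMul_eq_zero hdet ?_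
  ext j
  have h1 := hpow j
  change v ⬝ᵥ (((closedLoopC A B K)ᵀ ^ (j : ℕ)) *ᵥ fun i => (x i : ℂ)) = 0
  rw [← Matrix.transpose_pow, Matrix.mulVec_transpose, dotProduct_comm, ← Matrix.dotProduct_mulVec,
    h1, dotProduct_smul, dotProduct_comm, hvx', smul_zero]

/-- The gains without eigenvectors orthogonal to `x` are dense. -/
theorem IsControllable.dense_nonOrthogonalGains {A : Matrix (Fin n) (Fin n) ℝ}
    {B : Matrix (Fin n) (Fin m) ℝ} (h : IsControllable A B) {x : Fin n → ℝ} (hx : x ≠ 0) :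
    Dense (nonOrthogonalGains A B x) :=
  (h.dense_isObservable hx).mono fun _ hK => mem_nonOrthogonalGains hK

end Density

/-! ### Schur gains: openness and finite cost -/

section SpectralRadius

variable {n m : ℕ}

theorem spectralRadius_lt_one_iff {M : Matrix (Fin n) (Fin n) ℂ} :
    spectralRadius ℂ M < 1 ↔ ∀ μ : ℂ, (Matrix.scalar (Fin n) μ - M).det = 0 → ‖μ‖ < 1 := by
  let := Matrix.linftyOpNormedRing (n := Fin n) (α := ℂ)
  let := Matrix.linftyOpNormedAlgebra (n := Fin n) (R := ℂ) (α := ℂ)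
  have hmem : ∀ μ : ℂ, μ ∈ spectrum ℂ M ↔ (Matrix.scalar (Fin n) μ - M).det = 0 := by
    intro μ
    rw [Matrix.mem_spectrum_iff_isRoot_charpoly, IsRoot, Matrix.eval_charpoly]
  constructor
  · intro h μ hμ
    have h1 : (‖μ‖₊ : ℝ≥0∞) ≤ spectralRadius ℂ M :=
      le_iSup₂ (f := fun k (_ : k ∈ spectrum ℂ M) => (‖k‖₊ : ℝ≥0∞)) μ ((hmem μ).2 hμ)
    exact_mod_cast h1.trans_lt h
  · intro h
    rcases (spectrum ℂ M).eq_empty_or_nonempty with he | hne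
    · simp [spectralRadius, he]
    · have := spectrum.spectralRadius_lt_of_forall_lt_of_nonempty (r := 1) hne
        fun k hk => by exact_mod_cast h k ((hmem k).1 hk)
      simpa using this

theorem linfty_nnnorm_apply_le (M : Matrix (Fin n) (Fin n) ℂ) (i j : Fin n) :
    letI := Matrix.linftyOpNormedRing (n := Fin n) (α := ℂ)
    ‖M i j‖₊ ≤ ‖M‖₊ := by
  let := Matrix.linftyOpNormedRing (n := Fin n) (α := ℂ)
  rw [Matrix.linfty_opNNNorm_def]
  exact (Finset.single_le_sum (f := fun j => ‖M i j‖₊) (fun _ _ => zero_le)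
    (Finset.mem_univ j)).trans (Finset.le_sup (f := fun i => ∑ j, ‖M i j‖₊) (Finset.mem_univ i))

theorem eventually_linfty_nnnorm_pow_le {M : Matrix (Fin n) (Fin n) ℂ}
    (h : spectralRadius ℂ M < 1) :
    letI := Matrix.linftyOpNormedRing (n := Fin n) (α := ℂ)
    ∃ r : ℝ≥0, r < 1 ∧ ∀ᶠ k : ℕ in atTop, ‖M ^ k‖₊ ≤ r ^ k := by
  let := Matrix.linftyOpNormedRing (n := Fin n) (α := ℂ)
  let := Matrix.linftyOpNormedAlgebra (n := Fin n) (R := ℂ) (α := ℂ)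
  have : CompleteSpace (Matrix (Fin n) (Fin n) ℂ) := FiniteDimensional.complete ℂ _
  obtain ⟨r, hr, hr1⟩ := ENNReal.lt_iff_exists_nnreal_btwn.1 h
  refine ⟨r, by exact_mod_cast hr1, ?_⟩
  have hlim := spectrum.pow_nnnorm_pow_one_div_tendsto_nhds_spectralRadius M
  filter_upwards [hlim.eventually_lt_const hr, eventually_gt_atTop 0] with k hk hk0
  have hk0' : (k : ℝ) ≠ 0 := by positivity
  have h1 := ENNReal.rpow_le_rpow hk.le (Nat.cast_nonneg k : (0 : ℝ) ≤ k)
  rw [← ENNReal.rpow_mul, one_div, inv_mul_cancel₀ hk0', ENNReal.rpow_one,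
    ENNReal.rpow_natCast] at h1
  exact_mod_cast h1

theorem closedLoopC_pow_apply (A : Matrix (Fin n) (Fin n) ℝ) (B : Matrix (Fin n) (Fin m) ℝ)
    (K : Matrix (Fin m) (Fin n) ℝ) (k : ℕ) :
    closedLoopC A B K ^ k = (closedLoop A B K ^ k).map ((↑) : ℝ → ℂ) := by
  have := map_pow (Complex.ofRealHom.mapMatrix : Matrix (Fin n) (Fin n) ℝ →+* _)
    (closedLoop A B K) k
  exact this.symm

theorem continuous_closedLoopC (A : Matrix (Fin n) (Fin n) ℝ) (B : Matrix (Fin n) (Fin m) ℝ) :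
    Continuous (closedLoopC A B) := by
  unfold closedLoopC closedLoop
  exact (continuous_const.sub (continuous_const.matrix_mul continuous_id)).matrix_map
    Complex.continuous_ofReal

/-- By Gelfand's formula some power of the closed loop has norm below 1. This persists nearby and
bounds the spectral radius, since `ρ(M) ≤ ‖Mᵏ‖^(1/k)`. -/
theorem isOpen_schurStabilizing (A : Matrix (Fin n) (Fin n) ℝ) (B : Matrix (Fin n) (Fin m) ℝ) :
    IsOpen (schurStabilizing A B) := by
  rw [isOpen_iff_mem_nhds]
  intro K hK
  obtain ⟨r, hr, hev⟩ := eventually_linfty_nnnorm_pow_le hK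
  obtain ⟨k, hk, hk0⟩ := (hev.and (eventually_gt_atTop 0)).exists
  obtain ⟨p, rfl⟩ := Nat.exists_eq_succ_of_ne_zero hk0.ne'
  let := Matrix.linftyOpNormedRing (n := Fin n) (α := ℂ)
  let := Matrix.linftyOpNormedAlgebra (n := Fin n) (R := ℂ) (α := ℂ)
  have : CompleteSpace (Matrix (Fin n) (Fin n) ℂ) := FiniteDimensional.complete ℂ _
  have hlt : ‖closedLoopC A B K ^ (p + 1)‖₊ < 1 := hk.trans_lt (pow_lt_one₀ zero_le hr (by omega))
  -- Row sums of absolute values are visibly continuous for the entrywise topology on gains.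
  rw [Matrix.linfty_opNNNorm_def, Finset.sup_lt_iff (by simp)] at hlt
  have hopen : ∀ᶠ K' in 𝓝 K, ∀ i, ∑ j, ‖(closedLoopC A B K' ^ (p + 1)) i j‖₊ < 1 := by
    rw [eventually_all]
    intro i
    have hc : Continuous fun K' => ∑ j, ‖(closedLoopC A B K' ^ (p + 1)) i j‖₊ :=
      continuous_finsetSum _ fun j _ =>
        (((continuous_closedLoopC A B).pow (p + 1)).matrix_elem i j).nnnorm
    exact hc.continuousAt.eventually_lt_const (hlt i (Finset.mem_univ i))
  filter_upwards [hopen] with K' hK'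
  have h1 : ‖closedLoopC A B K' ^ (p + 1)‖₊ < 1 := by
    rw [Matrix.linfty_opNNNorm_def, Finset.sup_lt_iff (by simp)]
    exact fun i _ => hK' i
  -- The bound below contains `‖1‖`, which equals 1 only for `n > 0`.
  rcases Nat.eq_zero_or_pos n with rfl | hn
  · exact spectralRadius_lt_one_iff.2 fun μ hμ => by simp at hμ
  have : Nonempty (Fin n) := ⟨⟨0, hn⟩⟩
  have h2 := spectrum.spectralRadius_le_pow_nnnorm_pow_one_div ℂ (closedLoopC A B K') p
  refine h2.trans_lt ?_
  rw [show (‖(1 : Matrix (Fin n) (Fin n) ℂ)‖₊ : ℝ≥0∞) = 1 by simp, ENNReal.one_rpow, mul_one]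
  exact ENNReal.rpow_lt_one (by exact_mod_cast h1) (by positivity)

/-- The entries of the trajectory are eventually bounded by a geometric sequence, and the cost is
quadratic in them. -/
theorem schurStabilizing_subset_effectiveDomain (A : Matrix (Fin n) (Fin n) ℝ)
    (B : Matrix (Fin n) (Fin m) ℝ) (Q : Matrix (Fin n) (Fin n) ℝ) (R : Matrix (Fin m) (Fin m) ℝ)
    (x₀ : Fin n → ℝ) : schurStabilizing A B ⊆ effectiveDomain A B Q R x₀ := by
  intro K hK
  obtain ⟨r, hr, hev⟩ := eventually_linfty_nnnorm_pow_le hK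
  have htraj : ∀ᶠ k : ℕ in atTop, ∀ i, |trajectory A B x₀ K k i| ≤ (r : ℝ) ^ k * ∑ j, |x₀ j| := by
    filter_upwards [hev] with k hk i
    rw [trajectory, Matrix.mulVec, dotProduct, Finset.mul_sum]
    refine (Finset.abs_sum_le_sum_abs _ _).trans (Finset.sum_le_sum fun j _ => ?_)
    rw [abs_mul]
    refine mul_le_mul_of_nonneg_right ?_ (abs_nonneg _)
    have h1 := (linfty_nnnorm_apply_le (closedLoopC A B K ^ k) i j).trans hk
    rw [closedLoopC_pow_apply, Matrix.map_apply] at h1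
    have h2 : ‖(((closedLoop A B K ^ k) i j : ℝ) : ℂ)‖ ≤ (r : ℝ) ^ k := by exact_mod_cast h1
    simpa using h2
  have hr' : (r : ℝ) ^ 2 < 1 := by
    have : (r : ℝ) < 1 := by exact_mod_cast hr
    exact pow_lt_one₀ r.2 this two_ne_zero
  have hprod : ∀ i j, Summable fun k => trajectory A B x₀ K k i * trajectory A B x₀ K k j := by
    intro i j
    refine Summable.of_norm_bounded_eventually_nat
      (g := fun k => (∑ j, |x₀ j|) ^ 2 * ((r : ℝ) ^ 2) ^ k)
      ((summable_geometric_of_lt_one (by positivity) hr').mul_left _) ?_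
    filter_upwards [htraj] with k hk
    rw [Real.norm_eq_abs, abs_mul]
    calc _ ≤ ((r : ℝ) ^ k * ∑ j, |x₀ j|) * ((r : ℝ) ^ k * ∑ j, |x₀ j|) :=
          mul_le_mul (hk i) (hk j) (abs_nonneg _) ((abs_nonneg _).trans (hk i))
      _ = _ := by ring
  have hquad : ∀ P : Matrix (Fin n) (Fin n) ℝ,
      Summable fun k => trajectory A B x₀ K k ⬝ᵥ (P *ᵥ trajectory A B x₀ K k) := by
    intro P
    have : ∀ k, trajectory A B x₀ K k ⬝ᵥ (P *ᵥ trajectory A B x₀ K k) =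
        ∑ i, ∑ j, P i j * (trajectory A B x₀ K k i * trajectory A B x₀ K k j) := by
      intro k
      simp only [dotProduct, Matrix.mulVec, Finset.mul_sum]
      exact Finset.sum_congr rfl fun i _ => Finset.sum_congr rfl fun j _ => by ring
    simp_rw [this]
    exact summable_sum fun i _ => summable_sum fun j _ => (hprod i j).mul_left _
  have hsum : Summable (stageCost A B Q R x₀ K) := by
    refine ((hquad Q).add (hquad (Kᵀ * R * K))).congr fun k => ?_
    rw [stageCost, ← Matrix.mulVec_mulVec, ← Matrix.mulVec_mulVec, Matrix.dotProduct_mulVec _ Kᵀ,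
      Matrix.vecMul_transpose]
  exact hsum.tsum_ofReal_lt_top

end SpectralRadius

/-! ### Pushing eigenvalues out of the unit disc -/

section Perturbation

variable {n m : ℕ}

theorem exists_left_eigenvector_of_det {ι : Type*} [Fintype ι] [DecidableEq ι] {R : Type*}
    [CommRing R] [IsDomain R] {M : Matrix ι ι R} {μ : R}
    (h : (Matrix.scalar ι μ - M).det = 0) : ∃ w ≠ 0, w ᵥ* M = μ • w := by
  obtain ⟨w, hw, h1⟩ := Matrix.exists_vecMul_eq_zero_iff.2 h
  refine ⟨w, hw, ?_⟩
  rw [Matrix.vecMul_sub, sub_eq_zero] at h1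
  rw [← h1]
  ext i
  simp [mul_comm]

theorem det_eq_zero_of_left_eigenvector {ι : Type*} [Fintype ι] [DecidableEq ι] {R : Type*}
    [CommRing R] [IsDomain R] {M : Matrix ι ι R} {μ : R} {w : ι → R} (hw : w ≠ 0)
    (h : w ᵥ* M = μ • w) : (Matrix.scalar ι μ - M).det = 0 := by
  refine Matrix.exists_vecMul_eq_zero_iff.1 ⟨w, hw, ?_⟩
  rw [Matrix.vecMul_sub, h]
  ext i
  simp

/-- A matrix with `|det| > 1` has an eigenvalue outside the closed unit disc. -/
theorem exists_eigenvalue_of_one_lt_norm_det {ι : Type*} [Fintype ι] [DecidableEq ι]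
    {L : Matrix ι ι ℂ} (h : 1 < ‖L.det‖) :
    ∃ μ : ℂ, 1 < ‖μ‖ ∧ ∃ p ≠ 0, p ᵥ* L = μ • p := by
  by_contra! hcon
  refine h.not_ge ?_
  rw [Matrix.det_eq_prod_roots_charpoly]
  refine Multiset.prod_induction (fun z : ℂ => ‖z‖ ≤ 1) _ (fun a b ha hb => ?_) (by simp) ?_
  · rw [norm_mul]
    exact mul_le_one₀ ha (norm_nonneg _) hb
  · intro μ hμ
    by_contra! h1
    have hroot := isRoot_of_mem_roots hμ
    rw [IsRoot, Matrix.eval_charpoly] at hroot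
    obtain ⟨p, hp, hpL⟩ := exists_left_eigenvector_of_det hroot
    exact hcon μ h1 p hp hpL

/-- The Popov–Belevitch–Hautus condition: left eigenvectors of the closed loop do not
annihilate `B`. -/
theorem IsControllable.vecMul_ne_zero {A : Matrix (Fin n) (Fin n) ℝ}
    {B : Matrix (Fin n) (Fin m) ℝ} (h : IsControllable A B) {K : Matrix (Fin m) (Fin n) ℝ}
    {μ : ℂ} {w : Fin n → ℂ} (hw : w ≠ 0) (hμ : w ᵥ* closedLoopC A B K = μ • w) :
    w ᵥ* B.map ((↑) : ℝ → ℂ) ≠ 0 := by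
  intro hB
  -- The complex `w` is read as a real-linear map on `ℝⁿ`, so that its kernel is a real subspace to
  -- which reachability applies.
  set f : (Fin n → ℝ) →ₗ[ℝ] ℂ := Fintype.linearCombination ℝ w with hf
  have hfv : ∀ v, f v = w ⬝ᵥ (fun i => (v i : ℂ)) := by
    intro v
    simp [hf, Fintype.linearCombination_apply, dotProduct, mul_comm]
  have hfB : ∀ u, f (B *ᵥ u) = 0 := by
    intro u
    have h1 : (fun i => ((B *ᵥ u) i : ℂ)) = B.map ((↑) : ℝ → ℂ) *ᵥ fun i => (u i : ℂ) := by
      ext i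
      exact RingHom.map_mulVec Complex.ofRealHom B u i
    rw [hfv, h1, Matrix.dotProduct_mulVec, hB, zero_dotProduct]
  have htop := isReachable_of_isControllable h (LinearMap.ker f) (fun v hv => ?_)
    (fun u => by simpa using hfB u)
  · refine hw (funext fun i => ?_)
    have : Pi.single i 1 ∈ LinearMap.ker f := by rw [htop]; trivial
    simpa [hf, Fintype.linearCombination_apply_single] using this
  · have h1 : A *ᵥ v = closedLoop A B K *ᵥ v + B *ᵥ (K *ᵥ v) := by
      simp [closedLoop, Matrix.sub_mulVec]
    have h2 : (fun i => ((closedLoop A B K *ᵥ v) i : ℂ)) =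
        closedLoopC A B K *ᵥ fun i => (v i : ℂ) := by
      ext i
      exact RingHom.map_mulVec Complex.ofRealHom (closedLoop A B K) v i
    rw [LinearMap.mem_ker] at hv ⊢
    rw [Matrix.mulVecLin_apply, h1, map_add, hfB, add_zero, hfv, h2, Matrix.dotProduct_mulVec, hμ,
      smul_dotProduct, ← hfv, hv, smul_zero]

theorem closedLoopC_sub_smul (A : Matrix (Fin n) (Fin n) ℝ) (B : Matrix (Fin n) (Fin m) ℝ)
    (K F : Matrix (Fin m) (Fin n) ℝ) (ε : ℝ) :
    closedLoopC A B (K - ε • F) = closedLoopC A B K +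
      (ε : ℂ) • (B.map ((↑) : ℝ → ℂ) * F.map ((↑) : ℝ → ℂ)) := by
  have h1 : (B * F).map ((↑) : ℝ → ℂ) = B.map ((↑) : ℝ → ℂ) * F.map ((↑) : ℝ → ℂ) :=
    Matrix.map_mul (f := Complex.ofRealHom)
  rw [← h1]
  ext i j
  simp [closedLoopC, closedLoop, Matrix.mul_sub]
  ring

/-- For a real left eigenvector `w` and `β = w B ≠ 0`, the rank-one choice `F = (l β) wᵀ` keeps `w`
a left eigenvector and multiplies `l` by `1 + ε |β|²`. -/
theorem exists_destabilizing_of_real {A : Matrix (Fin n) (Fin n) ℝ}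
    {B : Matrix (Fin n) (Fin m) ℝ} (h : IsControllable A B) {K : Matrix (Fin m) (Fin n) ℝ}
    {l : ℝ} (hl : 1 ≤ |l|) (hdet : (Matrix.scalar (Fin n) (l : ℂ) - closedLoopC A B K).det = 0) :
    ∃ F : Matrix (Fin m) (Fin n) ℝ, ∀ ε : ℝ, 0 < ε → ∃ μ : ℂ, 1 < ‖μ‖ ∧
      (Matrix.scalar (Fin n) μ - closedLoopC A B (K - ε • F)).det = 0 := by
  have hdet' : (Matrix.scalar (Fin n) l - closedLoop A B K).det = 0 := by
    have h1 : Matrix.scalar (Fin n) (l : ℂ) - closedLoopC A B K =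
        Complex.ofRealHom.mapMatrix (Matrix.scalar (Fin n) l - closedLoop A B K) := by
      ext i j
      by_cases hij : i = j <;> simp [closedLoopC, hij]
    rw [h1, ← RingHom.map_det] at hdet
    simpa using hdet
  obtain ⟨w, hw, hwM⟩ := exists_left_eigenvector_of_det hdet'
  set wc : Fin n → ℂ := fun i => (w i : ℂ) with hwc
  have hwc0 : wc ≠ 0 := fun h0 => hw (funext fun i => by simpa [hwc] using congrFun h0 i)
  have hwcM : wc ᵥ* closedLoopC A B K = (l : ℂ) • wc := by
    ext i
    have h1 := RingHom.map_vecMul Complex.ofRealHom (closedLoop A B K) w i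
    rw [hwM] at h1
    rw [Pi.smul_apply, smul_eq_mul, Complex.ofRealHom_eq_coe, Complex.ofReal_mul] at h1
    exact h1.symm
  set β := w ᵥ* B with hβ
  have hβc : wc ᵥ* B.map ((↑) : ℝ → ℂ) = fun i => (β i : ℂ) := by
    ext i
    exact (RingHom.map_vecMul Complex.ofRealHom B w i).symm
  have hβ0 : β ≠ 0 := by
    intro h0
    refine h.vecMul_ne_zero hwc0 hwcM ?_
    rw [hβc, h0]
    ext i; simp
  have hκ : 0 < β ⬝ᵥ β := by
    exact lt_of_le_of_ne (Finset.sum_nonneg fun i _ => mul_self_nonneg _)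
      fun h0 => hβ0 (dotProduct_self_eq_zero.1 h0.symm)
  refine ⟨Matrix.vecMulVec (l • β) w, fun ε hε => ⟨((l * (1 + ε * (β ⬝ᵥ β)) : ℝ) : ℂ), ?_, ?_⟩⟩
  · rw [Complex.norm_real, Real.norm_eq_abs, abs_mul,
      abs_of_pos (a := 1 + ε * (β ⬝ᵥ β)) (by linarith [mul_pos hε hκ])]
    nlinarith [mul_pos hε hκ]
  · refine det_eq_zero_of_left_eigenvector hwc0 ?_
    have hF : (Matrix.vecMulVec (l • β) w).map ((↑) : ℝ → ℂ) =
        Matrix.vecMulVec ((l : ℂ) • fun i => (β i : ℂ)) wc := by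
      ext i j
      simp [Matrix.vecMulVec_apply, hwc, mul_assoc]
    have hκc : ((fun i => (β i : ℂ)) ⬝ᵥ fun i => (β i : ℂ)) = ((β ⬝ᵥ β : ℝ) : ℂ) := by
      simp [dotProduct]
    rw [closedLoopC_sub_smul, Matrix.vecMul_add, hwcM, Matrix.vecMul_smul, ← Matrix.vecMul_vecMul,
      hβc, hF, Matrix.vecMul_vecMulVec, dotProduct_smul, hκc]
    ext i
    simp
    ring

/-- A real perturbation must treat `w` and its conjugate together. With `F = 2 Re (g wᵀ)` their span
stays invariant, and the closed loop acts there by a 2×2 matrix `L` with `|det L| > 1`. -/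
theorem exists_destabilizing_of_nonreal {A : Matrix (Fin n) (Fin n) ℝ}
    {B : Matrix (Fin n) (Fin m) ℝ} (h : IsControllable A B) {K : Matrix (Fin m) (Fin n) ℝ}
    {l : ℂ} (hl : 1 ≤ ‖l‖) (hreal : conj l ≠ l)
    (hdet : (Matrix.scalar (Fin n) l - closedLoopC A B K).det = 0) :
    ∃ F : Matrix (Fin m) (Fin n) ℝ, ∀ ε : ℝ, 0 < ε → ∃ μ : ℂ, 1 < ‖μ‖ ∧
      (Matrix.scalar (Fin n) μ - closedLoopC A B (K - ε • F)).det = 0 := by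
  obtain ⟨w, hw, hwM⟩ := exists_left_eigenvector_of_det hdet
  set β := w ᵥ* B.map ((↑) : ℝ → ℂ) with hβ
  have hβ0 : β ≠ 0 := h.vecMul_ne_zero hw hwM
  have hstar : ∀ {k : ℕ} (P : Matrix (Fin n) (Fin k) ℝ),
      star w ᵥ* P.map ((↑) : ℝ → ℂ) = star (w ᵥ* P.map ((↑) : ℝ → ℂ)) := by
    intro k P
    ext i
    simp [Matrix.vecMul, dotProduct]
  have hwM' : star w ᵥ* closedLoopC A B K = conj l • star w := by
    rw [closedLoopC, hstar, ← closedLoopC, hwM]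
    ext i; simp
  -- This `g` makes the diagonal of `L` equal to `l (1 + ε κ)` and its conjugate; the off-diagonal
  -- terms are controlled by `|s| ≤ κ`.
  set g : Fin m → ℂ := l • star β with hg
  set κ : ℝ := ∑ i, ‖β i‖ ^ 2 with hκ
  have hκ0 : 0 < κ := by
    obtain ⟨i, hi⟩ := Function.ne_iff.1 hβ0
    refine Finset.sum_pos' (fun i _ => by positivity) ⟨i, Finset.mem_univ i, ?_⟩
    have := norm_pos_iff.2 hi
    positivity
  set s : ℂ := β ⬝ᵥ β with hs
  have hsκ : ‖s‖ ≤ κ := by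
    refine (norm_sum_le _ _).trans (Finset.sum_le_sum fun i _ => ?_)
    rw [norm_mul, sq]
  have hββ : β ⬝ᵥ star β = (κ : ℂ) := by
    simp [dotProduct, hκ, Complex.mul_conj, Complex.normSq_eq_norm_sq]
  have e1 : β ⬝ᵥ g = l * κ := by rw [hg, dotProduct_smul, hββ, smul_eq_mul]
  have e2 : β ⬝ᵥ star g = conj l * s := by
    rw [hg, star_smul, star_star, dotProduct_smul, smul_eq_mul]; rfl
  have e3 : star β ⬝ᵥ g = l * conj s := by
    rw [hg, dotProduct_smul, smul_eq_mul, Matrix.star_dotProduct_star]; rfl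
  have e4 : star β ⬝ᵥ star g = conj l * κ := by
    rw [Matrix.star_dotProduct_star, dotProduct_comm, e1]; simp
  refine ⟨Matrix.of fun i j => 2 * (g i * w j).re, fun ε hε => ?_⟩
  have hF : (Matrix.of fun i j => 2 * (g i * w j).re : Matrix (Fin m) (Fin n) ℝ).map
      ((↑) : ℝ → ℂ) = Matrix.vecMulVec g w + Matrix.vecMulVec (star g) (star w) := by
    ext i j
    have := Complex.add_conj (g i * w j)
    simp only [Matrix.map_apply, Matrix.of_apply, Matrix.add_apply, Matrix.vecMulVec_apply,
      Pi.star_apply]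
    rw [← this, map_mul]
    rfl
  set L : Matrix (Fin 2) (Fin 2) ℂ :=
    !![l + ε * (l * κ), ε * (conj l * s); ε * (l * conj s), conj l + ε * (conj l * κ)] with hL
  have hLdet : L.det = ((‖l‖ ^ 2 * ((1 + ε * κ) ^ 2 - ε ^ 2 * ‖s‖ ^ 2) : ℝ) : ℂ) := by
    have h1 := Complex.mul_conj' l
    have h2 := Complex.mul_conj' s
    rw [hL, Matrix.det_fin_two_of]
    push_cast
    rw [← h1, ← h2]
    ring
  have hLnorm : 1 < ‖L.det‖ := by
    rw [hLdet, Complex.norm_real, Real.norm_eq_abs]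
    refine lt_of_lt_of_le ?_ (le_abs_self _)
    have h1 : 1 ≤ ‖l‖ ^ 2 := one_le_pow₀ hl
    have h2 : ‖s‖ ^ 2 ≤ κ ^ 2 := by gcongr
    have h3 : ε ^ 2 * ‖s‖ ^ 2 ≤ ε ^ 2 * κ ^ 2 := by gcongr
    have h4 : 0 < ε * κ := mul_pos hε hκ0
    have h5 : 1 < (1 + ε * κ) ^ 2 - ε ^ 2 * ‖s‖ ^ 2 := by nlinarith
    nlinarith
  obtain ⟨μ, hμ, p, hp, hpL⟩ := exists_eigenvalue_of_one_lt_norm_det hLnorm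
  refine ⟨μ, hμ, ?_⟩
  have hp0 := congrFun hpL 0
  have hp1 := congrFun hpL 1
  simp only [hL, Matrix.vecMul, dotProduct, Fin.sum_univ_two, Matrix.of_apply, Matrix.cons_val_zero,
    Matrix.cons_val_one, Pi.smul_apply, smul_eq_mul, Matrix.cons_val', Matrix.cons_val_fin_one]
    at hp0 hp1
  refine det_eq_zero_of_left_eigenvector (w := p 0 • w + p 1 • star w) ?_ ?_
  -- Left eigenvectors `w` and `star w` belong to distinct eigenvalues, hence are independent.
  · intro hz
    have h1 := congrArg (fun y => y ᵥ* closedLoopC A B K) hz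
    simp only [Matrix.add_vecMul, Matrix.smul_vecMul, hwM, hwM', Matrix.zero_vecMul] at h1
    have hw0 : p 0 = 0 := by
      obtain ⟨i, hi⟩ := Function.ne_iff.1 hw
      have a1 := congrFun hz i
      have a2 := congrFun h1 i
      simp only [Pi.add_apply, Pi.smul_apply, Pi.star_apply, smul_eq_mul, Pi.zero_apply] at a1 a2
      have a3 : (l - conj l) * (p 0 * w i) = 0 := by linear_combination a2 - conj l * a1
      rcases mul_eq_zero.1 a3 with a4 | a4
      · exact absurd (sub_eq_zero.1 a4).symm hreal
      · exact (mul_eq_zero.1 a4).resolve_right hi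
    rw [hw0, zero_smul, zero_add] at hz
    have hw1 : p 1 = 0 := (smul_eq_zero.1 hz).resolve_right (star_ne_zero.2 hw)
    exact hp (funext fun i => by fin_cases i <;> simp [hw0, hw1])
  · rw [closedLoopC_sub_smul, hF]
    have b1 : w ᵥ* (B.map ((↑) : ℝ → ℂ) * (Matrix.vecMulVec g w +
        Matrix.vecMulVec (star g) (star w))) = (l * κ) • w + (conj l * s) • star w := by
      rw [← Matrix.vecMul_vecMul, ← hβ, Matrix.vecMul_add, Matrix.vecMul_vecMulVec,
        Matrix.vecMul_vecMulVec, e1, e2]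
    have b2 : star w ᵥ* (B.map ((↑) : ℝ → ℂ) * (Matrix.vecMulVec g w +
        Matrix.vecMulVec (star g) (star w))) = (l * conj s) • w + (conj l * κ) • star w := by
      rw [← Matrix.vecMul_vecMul, hstar, ← hβ, Matrix.vecMul_add, Matrix.vecMul_vecMulVec,
        Matrix.vecMul_vecMulVec, e3, e4]
    rw [Matrix.add_vecMul, Matrix.smul_vecMul, Matrix.smul_vecMul, Matrix.vecMul_add,
      Matrix.vecMul_add, hwM, hwM', Matrix.vecMul_smul, Matrix.vecMul_smul, b1, b2]
    ext i
    simp only [Pi.add_apply, Pi.smul_apply, Pi.star_apply, smul_eq_mul]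
    linear_combination w i * hp0 + star (w i) * hp1

/-- A gain that is not Schur stabilizing can be moved by arbitrarily small steps to gains with an
eigenvalue outside the closed unit disc. -/
theorem IsControllable.exists_destabilizing {A : Matrix (Fin n) (Fin n) ℝ}
    {B : Matrix (Fin n) (Fin m) ℝ} (h : IsControllable A B) {K : Matrix (Fin m) (Fin n) ℝ}
    {l : ℂ} (hl : 1 ≤ ‖l‖) (hdet : (Matrix.scalar (Fin n) l - closedLoopC A B K).det = 0) :
    ∃ F : Matrix (Fin m) (Fin n) ℝ, ∀ ε : ℝ, 0 < ε → ∃ μ : ℂ, 1 < ‖μ‖ ∧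
      (Matrix.scalar (Fin n) μ - closedLoopC A B (K - ε • F)).det = 0 := by
  by_cases hr : conj l = l
  · obtain ⟨r, rfl⟩ := Complex.conj_eq_iff_real.1 hr
    exact exists_destabilizing_of_real h (by simpa using hl) hdet
  · exact exists_destabilizing_of_nonreal h hl hr hdet

end Perturbation

/-! ### Finite cost, generic gains, and part (2) -/

section Main

variable {n m : ℕ}

open scoped MatrixOrder in
/-- A finite cost forces the controls to converge to zero. -/
theorem tendsto_control_of_mem_effectiveDomain {A : Matrix (Fin n) (Fin n) ℝ}
    {B : Matrix (Fin n) (Fin m) ℝ} {Q : Matrix (Fin n) (Fin n) ℝ} {R : Matrix (Fin m) (Fin m) ℝ}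
    (hQ : Q.PosSemidef) (hR : R.PosDef) {x₀ : Fin n → ℝ} {K : Matrix (Fin m) (Fin n) ℝ}
    (hK : K ∈ effectiveDomain A B Q R x₀) :
    Tendsto (fun k => K *ᵥ trajectory A B x₀ K k) atTop (𝓝 0) := by
  have h1 : Tendsto (stageCost A B Q R x₀ K) atTop (𝓝 0) := by
    have h2 := ENNReal.tendsto_atTop_zero_of_tsum_ne_top (ne_of_lt hK)
    have h3 := (ENNReal.tendsto_toReal ENNReal.zero_ne_top).comp h2
    refine h3.congr fun k => ?_
    exact ENNReal.toReal_ofReal (stageCost_nonneg A B hQ hR x₀ K k)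
  -- With `R = Sᴴ S`, the stage cost dominates the squared entries of `S K x_k`, and `S` is
  -- invertible.
  obtain ⟨S, hS, hSR⟩ : ∃ S : Matrix (Fin m) (Fin m) ℝ, IsUnit S ∧ R = Sᴴ * S :=
    by
    obtain ⟨S, hS⟩ := CStarAlgebra.nonneg_iff_eq_star_mul_self.1 hR.posSemidef.nonneg
    refine ⟨S, ?_, hS⟩
    have h2 := (Matrix.isUnit_iff_isUnit_det _).1 hR.isUnit
    rw [hS, Matrix.det_mul] at h2
    exact (Matrix.isUnit_iff_isUnit_det S).2 (isUnit_of_mul_isUnit_right h2)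
  have h4 : ∀ i, Tendsto (fun k => (S *ᵥ (K *ᵥ trajectory A B x₀ K k)) i) atTop (𝓝 0) := by
    intro i
    refine squeeze_zero_norm (a := fun k => √(stageCost A B Q R x₀ K k)) (fun k => ?_) ?_
    · refine Real.abs_le_sqrt ?_
      have h5 := hQ.dotProduct_mulVec_nonneg (trajectory A B x₀ K k)
      simp only [star_trivial] at h5
      rw [stageCost, hSR, Matrix.conjTranspose_eq_transpose_of_trivial, ← Matrix.mulVec_mulVec,
        Matrix.dotProduct_mulVec _ Sᵀ, Matrix.vecMul_transpose]
      refine le_add_of_nonneg_of_le h5 ?_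
      rw [dotProduct, sq]
      exact Finset.single_le_sum
        (f := fun i => (S *ᵥ (K *ᵥ trajectory A B x₀ K k)) i *
          (S *ᵥ (K *ᵥ trajectory A B x₀ K k)) i)
        (fun j _ => mul_self_nonneg _) (Finset.mem_univ i)
    · simpa using h1.sqrt
  have h6 := tendsto_pi_nhds.2 h4
  have hc : Continuous fun y : Fin m → ℝ => S⁻¹ *ᵥ y :=
    continuous_const.matrix_mulVec continuous_id
  have h7 := (hc.tendsto _).comp h6
  have h8 : S⁻¹ *ᵥ (fun _ => (0 : ℝ)) = 0 := Matrix.mulVec_zero _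
  rw [h8] at h7
  refine h7.congr fun k => ?_
  have hdet : IsUnit S.det := (Matrix.isUnit_iff_isUnit_det S).1 hS
  simp only [Function.comp_apply]
  change S⁻¹ *ᵥ (S *ᵥ (K *ᵥ trajectory A B x₀ K k)) = _
  rw [Matrix.mulVec_mulVec _ S⁻¹ S, Matrix.nonsing_inv_mul _ hdet, Matrix.one_mulVec]

/-- If `K Mᵏ x₀ → 0` for a cyclic vector `x₀` of `M`, then `K Mᵏ → 0`. -/
theorem tendsto_mul_pow_of_cyclic {M : Matrix (Fin n) (Fin n) ℝ} {K : Matrix (Fin m) (Fin n) ℝ}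
    {x₀ : Fin n → ℝ} (hcyc : (krylovMatrix M x₀).det ≠ 0)
    (h : Tendsto (fun k => K *ᵥ (M ^ k *ᵥ x₀)) atTop (𝓝 0)) :
    Tendsto (fun k => K * M ^ k) atTop (𝓝 0) := by
  -- Column `j` is `K Mᵏ⁺ʲ x₀`, a shift of the given null sequence.
  have h1 : Tendsto (fun k => K * M ^ k * krylovMatrix M x₀) atTop (𝓝 0) := by
    refine tendsto_pi_nhds.2 fun i => tendsto_pi_nhds.2 fun j => ?_
    have h2 := ((tendsto_pi_nhds.1 h i).comp (tendsto_add_atTop_nat (j : ℕ)))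
    refine h2.congr fun k => ?_
    simp only [Function.comp_apply]
    rw [pow_add, ← Matrix.mulVec_mulVec, Matrix.mulVec_mulVec]
    rfl
  have hc : Continuous fun P : Matrix (Fin m) (Fin n) ℝ => P * (krylovMatrix M x₀)⁻¹ :=
    continuous_id.matrix_mul continuous_const
  have h3 := (hc.tendsto 0).comp h1
  rw [Matrix.zero_mul] at h3
  refine h3.congr fun k => ?_
  simp only [Function.comp_apply]
  rw [Matrix.mul_assoc, Matrix.mul_nonsing_inv _ (isUnit_iff_ne_zero.2 hcyc), Matrix.mul_one]

/-- A gain with finite cost is Schur stabilizing, if `x₀` is cyclic for the closed loop and the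
closed loop shares no eigenvalue with `A`. -/
theorem mem_schurStabilizing_of_generic {A : Matrix (Fin n) (Fin n) ℝ}
    {B : Matrix (Fin n) (Fin m) ℝ} {Q : Matrix (Fin n) (Fin n) ℝ} {R : Matrix (Fin m) (Fin m) ℝ}
    (hQ : Q.PosSemidef) (hR : R.PosDef) {x₀ : Fin n → ℝ} {K : Matrix (Fin m) (Fin n) ℝ}
    (hK : K ∈ effectiveDomain A B Q R x₀) (hcyc : (krylovMatrix (closedLoop A B K) x₀).det ≠ 0)
    (hspec : (aeval (closedLoop A B K) A.charpoly).det ≠ 0) : K ∈ schurStabilizing A B := by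
  have hlim := tendsto_mul_pow_of_cyclic hcyc (tendsto_control_of_mem_effectiveDomain hQ hR hK)
  refine spectralRadius_lt_one_iff.2 fun μ hμ => ?_
  by_contra! hge
  obtain ⟨v, hv, hv0⟩ := Matrix.exists_mulVec_eq_zero_iff.2 hμ
  have hMv : closedLoopC A B K *ᵥ v = μ • v := by
    rw [Matrix.sub_mulVec, sub_eq_zero] at hv0
    rw [← hv0]
    ext i
    simp
  have hpow : ∀ k : ℕ, (closedLoopC A B K ^ k) *ᵥ v = μ ^ k • v := by
    intro k
    induction k with
    | zero => simp
    | succ k ih =>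
      rw [pow_succ', ← Matrix.mulVec_mulVec, ih, Matrix.mulVec_smul, hMv, smul_smul, pow_succ]
  -- `K Mᵏ v = μᵏ K v` tends to 0, while `|μ|ᵏ ≥ 1`.
  have hKv : K.map ((↑) : ℝ → ℂ) *ᵥ v = 0 := by
    have h1 : Tendsto (fun k => (K * closedLoop A B K ^ k).map ((↑) : ℝ → ℂ) *ᵥ v) atTop
        (𝓝 0) := by
      have hc : Continuous fun P : Matrix (Fin m) (Fin n) ℝ => P.map ((↑) : ℝ → ℂ) *ᵥ v :=
        (continuous_id.matrix_map Complex.continuous_ofReal).matrix_mulVec continuous_const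
      have h2 := (hc.tendsto 0).comp hlim
      simpa [Function.comp_def] using h2
    ext i
    refine tendsto_nhds_unique (l := (atTop : Filter ℕ))
      (f := fun _ : ℕ => (K.map ((↑) : ℝ → ℂ) *ᵥ v) i) tendsto_const_nhds ?_
    refine squeeze_zero_norm (fun k => ?_) (by simpa using (tendsto_pi_nhds.1 h1 i).norm)
    have h3 : (K * closedLoop A B K ^ k).map ((↑) : ℝ → ℂ) =
        K.map ((↑) : ℝ → ℂ) * closedLoopC A B K ^ k := by
      rw [closedLoopC_pow_apply]
      exact Matrix.map_mul (f := Complex.ofRealHom)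
    rw [h3, ← Matrix.mulVec_mulVec, hpow, Matrix.mulVec_smul, Pi.smul_apply, norm_smul, norm_pow]
    exact le_mul_of_one_le_left (norm_nonneg _) (one_le_pow₀ hge)
  have hAv : A.map ((↑) : ℝ → ℂ) *ᵥ v = μ • v := by
    have h1 : closedLoopC A B K = A.map ((↑) : ℝ → ℂ) -
        B.map ((↑) : ℝ → ℂ) * K.map ((↑) : ℝ → ℂ) := by
      rw [closedLoopC, closedLoop, Matrix.map_sub _ Complex.ofReal_sub]
      congr 1
      exact Matrix.map_mul (f := Complex.ofRealHom)
    rw [← hMv, h1, Matrix.sub_mulVec, ← Matrix.mulVec_mulVec, hKv, Matrix.mulVec_zero, sub_zero]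
  have hroot : A.charpoly.aeval μ = 0 := by
    have h1 : (Matrix.scalar (Fin n) μ - A.map ((↑) : ℝ → ℂ)).det = 0 := by
      refine Matrix.exists_mulVec_eq_zero_iff.1 ⟨v, hv, ?_⟩
      rw [Matrix.sub_mulVec, hAv]
      ext i
      simp
    rw [← Matrix.eval_charpoly] at h1
    have h2 := Matrix.charpoly_map A Complex.ofRealHom
    change (A.map ((↑) : ℝ → ℂ)).charpoly = _ at h2
    rw [h2, eval_map] at h1
    exact h1
  have haev : ∀ q : ℝ[X], aeval (closedLoopC A B K) q *ᵥ v = aeval μ q • v := by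
    intro q
    induction q using Polynomial.induction_on' with
    | add p q hp hq => rw [map_add, map_add, Matrix.add_mulVec, hp, hq, add_smul]
    | monomial k a =>
      rw [aeval_monomial, aeval_monomial, ← Matrix.mulVec_mulVec, hpow,
        Algebra.algebraMap_eq_smul_one, Matrix.smul_mulVec, Matrix.one_mulVec, ← smul_assoc]
      simp [Algebra.smul_def]
  have h1 := haev A.charpoly
  rw [hroot, zero_smul] at h1
  have h2 : (aeval (closedLoopC A B K) A.charpoly).det = 0 :=
    Matrix.exists_mulVec_eq_zero_iff.1 ⟨v, hv, h1⟩
  have h3 : closedLoopC A B K = Complex.ofRealAm.mapMatrix (closedLoop A B K) := rfl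
  rw [h3, aeval_algHom_apply, ← AlgHom.map_det] at h2
  exact hspec (by simpa using h2)

/-- For a limit of Schur stabilizing gains the closed loop has no eigenvalue outside the closed unit
disc. -/
theorem norm_le_one_of_mem_closure {A : Matrix (Fin n) (Fin n) ℝ}
    {B : Matrix (Fin n) (Fin m) ℝ} {K : Matrix (Fin m) (Fin n) ℝ}
    (hK : K ∈ closure (schurStabilizing A B)) {μ : ℂ}
    (hμ : (Matrix.scalar (Fin n) μ - closedLoopC A B K).det = 0) : ‖μ‖ ≤ 1 := by
  by_contra! hlt
  -- The determinant is the product of the `μ - z` over the `n` eigenvalues `z`, all with `|z| < 1`;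
  -- the lower bound passes to the limit.
  have hbound : ∀ K' ∈ schurStabilizing A B,
      (‖μ‖ - 1) ^ n ≤ ‖(Matrix.scalar (Fin n) μ - closedLoopC A B K').det‖ := by
    intro K' hK'
    have hK'' := spectralRadius_lt_one_iff.1 hK'
    set p := (closedLoopC A B K').charpoly with hp
    have hsplit : p.Splits := IsAlgClosed.splits p
    have hmonic : p.Monic := Matrix.charpoly_monic _
    have hcard : p.roots.card = n := by
      rw [← hsplit.natDegree_eq_card_roots, hp, Matrix.charpoly_natDegree_eq_dim, Fintype.card_fin]
    rw [← Matrix.eval_charpoly, ← hp, hsplit.eval_eq_prod_roots_of_monic hmonic]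
    have hroots : ∀ z ∈ p.roots, ‖z‖ < 1 := by
      intro z hz
      have h1 := isRoot_of_mem_roots hz
      rw [IsRoot, hp, Matrix.eval_charpoly] at h1
      exact hK'' z h1
    rw [← hcard]
    clear_value p
    generalize p.roots = S at hroots
    induction S using Multiset.induction_on with
    | empty => simp
    | cons a S ih =>
      have h2 := ih fun z hz => hroots z (Multiset.mem_cons_of_mem hz)
      have h3 := hroots a (Multiset.mem_cons_self a S)
      have h4 := norm_sub_norm_le μ a
      rw [Multiset.card_cons, pow_succ', Multiset.map_cons, Multiset.prod_cons, norm_mul]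
      exact mul_le_mul (by linarith) h2 (pow_nonneg (by linarith) _) (norm_nonneg _)
  have hc : Continuous fun K' => ‖(Matrix.scalar (Fin n) μ - closedLoopC A B K').det‖ :=
    ((continuous_const.sub (continuous_closedLoopC A B)).matrix_det).norm
  have h1 := closure_minimal (t := {K' | (‖μ‖ - 1) ^ n ≤
    ‖(Matrix.scalar (Fin n) μ - closedLoopC A B K').det‖}) hbound
    (isClosed_le continuous_const hc) hK
  rw [Set.mem_ofPred_eq, hμ, norm_zero] at h1
  exact absurd (pow_pos (sub_pos.2 hlt) n) h1.not_gt

/-- The gains with finite cost are Schur stabilizing in the interior. -/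
theorem IsControllable.interior_effectiveDomain_subset {A : Matrix (Fin n) (Fin n) ℝ}
    {B : Matrix (Fin n) (Fin m) ℝ} (h : IsControllable A B) {Q : Matrix (Fin n) (Fin n) ℝ}
    {R : Matrix (Fin m) (Fin m) ℝ} (hQ : Q.PosSemidef) (hR : R.PosDef) {x₀ : Fin n → ℝ}
    (hx₀ : x₀ ≠ 0) : interior (effectiveDomain A B Q R x₀) ⊆ schurStabilizing A B := by
  have hdense : Dense {K | (krylovMatrix (closedLoop A B K) x₀).det ≠ 0 ∧
      (aeval (closedLoop A B K) A.charpoly).det ≠ 0} := by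
    refine (h.dense_isCyclic hx₀).inter_of_isOpen_left
      (h.dense_isUnit_aeval A.charpoly_monic.ne_zero) ?_
    have hcl : Continuous (closedLoop A B) :=
      continuous_const.sub (continuous_const.matrix_mul continuous_id)
    have hc : Continuous fun K => (krylovMatrix (closedLoop A B K) x₀).det := by
      refine Continuous.matrix_det (continuous_matrix fun i j => ?_)
      exact (continuous_apply i).comp ((hcl.pow (j : ℕ)).matrix_mulVec continuous_const)
    exact isOpen_ne_fun hc continuous_const
  have hcl : interior (effectiveDomain A B Q R x₀) ⊆ closure (schurStabilizing A B) := by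
    refine (hdense.open_subset_closure_inter isOpen_interior).trans (closure_mono ?_)
    rintro K ⟨hK, hK1, hK2⟩
    exact mem_schurStabilizing_of_generic hQ hR (interior_subset hK) hK1 hK2
  intro K hK
  refine spectralRadius_lt_one_iff.2 fun l hl => ?_
  by_contra! hge
  obtain ⟨F, hF⟩ := h.exists_destabilizing hge hl
  -- A small destabilizing step remains in the interior, hence in the closure of the Schur gains.
  have hc : Continuous fun ε : ℝ => K - ε • F := by fun_prop
  have hev : ∀ᶠ ε in 𝓝[>] (0 : ℝ), K - ε • F ∈ interior (effectiveDomain A B Q R x₀) := by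
    refine (hc.continuousAt.eventually_mem ?_).filter_mono nhdsWithin_le_nhds
    simpa using isOpen_interior.mem_nhds hK
  obtain ⟨ε, hε, hε0⟩ := (hev.and self_mem_nhdsWithin).exists
  obtain ⟨μ, hμ, hdet⟩ := hF ε hε0
  exact hμ.not_ge (norm_le_one_of_mem_closure (hcl hε) hdet)

end Main

end LQR

theorem mainTheorem12 {n m : ℕ} (A : Matrix (Fin n) (Fin n) ℝ) (B : Matrix (Fin n) (Fin m) ℝ)
    (hAB : LQR.IsControllable A B) :
    (∀ x : Fin n → ℝ, x ≠ 0 → Dense (LQR.nonOrthogonalGains A B x)) ∧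
    (∀ (Q : Matrix (Fin n) (Fin n) ℝ) (R : Matrix (Fin m) (Fin m) ℝ),
      Q.PosSemidef → R.PosDef → ∀ x₀ : Fin n → ℝ, x₀ ≠ 0 →
        interior (LQR.effectiveDomain A B Q R x₀) = LQR.schurStabilizing A B) :=
  ⟨fun _ hx => hAB.dense_nonOrthogonalGains hx, fun Q R hQ hR x₀ hx₀ =>
    (hAB.interior_effectiveDomain_subset hQ hR hx₀).antisymm
      ((LQR.isOpen_schurStabilizing A B).subset_interior_iff.2
        (LQR.schurStabilizing_subset_effectiveDomain A B Q R x₀))⟩
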